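/- Let $q$ be a prime, let $\log$ denote the logarithm to base $2$, and put $D(q):=H(U_1+U_2)-\log q$, where $U_1,U_2$ are independent and uniform on $\{0,\dots,q-1\}$, the sum is taken in $\mathbb Z$, and $H$ is the Shannon entropy in bits. For every $n$ let $0\le k_2^{(n)}\le k_1^{(n)}\le n$ be integers such that the limits $R_j:=\lim_{n\to\infty}\frac{k_j^{(n)}}{n}\log q$ ($j=1,2$) exist, and let $d^{(n)}\in\mathbb F_q^n$ be a fixed vector. Let $G^{(n)}$ be a random $n\times k_1^{(n)}$ matrix over $\mathbb F_q$ whose entries are independent and uniform on $\mathbb F_q$, and define the nested codes and the coset $$\mathcal C_1=\{G^{(n)}m: m\in\mathbb F_q^{k_1^{(n)}}\},\qquad \mathcal C_2=\Big\{G^{(n)}\begin{bmatrix}x\\0\end{bmatrix}: x\in\mathbb F_q^{k_2^{(n)}}\Big\}\subseteq\mathcal C_1,\qquad \mathcal C_1'=\{t+d^{(n)}: t\in\mathcal C_1\}.$$ View $\mathcal C_1'$ and $\mathcal C_2$ as sets of integer vectors with entries in $\{0,\dots,q-1\}$, and let $\mathcal C_1'+\mathcal C_2\subseteq\mathbb Z^n$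 be their sumset under integer addition. Given $G^{(n)}$, let $T_1,T_2$ be independent and uniform on $\mathcal C_1'$, $\mathcal C_2$ respectively, and let $P_{\mathcal S}$ be the distribution of the integer sum $T_1+T_2$. Then there are deterministic real sequences $\varepsilon_n\searrow 0$ and $\eta_n\to 0$ such that, with probability over $G^{(n)}$ tending to $1$ as $n\to\infty$, there exists a set $\mathcal K_N^{(n)}\subseteq\mathcal C_1'+\mathcal C_2$ with the following three properties: 1. $P_{\mathcal S}(\mathcal K_N^{(n)})\ge 1-\eta_n$ (that is, $\mathcal K_N^{(n)}$ is a typical sumset); 2. $2^{-n\varepsilon_n}M_n\le|\mathcal K_N^{(n)}|\le 2^{n\varepsilon_n}M_n$, where $M_n:=\min\{2^{n(R_1+R_2)},\,2^{n(\max\{R_1,R_2\}+D(q))}\}$; 3. for all $w\in\mathcal K_N^{(n)}$, $2^{-n\varepsilon_n}M_n^{-1}\le P_{\mathcal S}(w)\le 2^{n\varepsilon_n}M_n^{-1}$, where $M_n^{-1}=\max\{2^{-n(R_1+R_2)},\,2^{-n(\max\{R_1,R_2\}+D(q))}\}$. -/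

import Mathlib

open MeasureTheory ProbabilityTheory Filter Topology
open scoped Matrix Pointwise

noncomputable section

namespace TypicalSumset

/-- The alphabet `{0, …, q - 1}`, as a set of integers. -/
def alphabet (q : ℕ) : Set ℤ := Set.Ico 0 (q : ℤ)

/-- The law of `T₁ + T₂`, where `T₁` and `T₂` are independent and uniformly distributed on the
(finite, nonempty) sets `A` and `B` respectively. -/
def sumLaw {V : Type*} [AddCommGroup V] [MeasurableSpace V] (A B : Set V) : Measure V :=
  ((uniformOn A).prod (uniformOn B)).map (fun p => p.1 + p.2)

/-- The entropy, in bits, of a distribution on `ℤ` supported in the finite set `S`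
(with the usual convention `0 log 0 = 0`). -/
def entropyBits (S : Finset ℤ) (μ : Measure ℤ) : ℝ :=
  -∑ a ∈ S, μ.real {a} * Real.logb 2 (μ.real {a})

/-- `D(q) = H(U₁ + U₂) - log q` with `U₁, U₂` independent and uniform on `{0, …, q - 1}`,
so that `U₁ + U₂` takes values in `{0, …, 2q - 2}`. -/
def D (q : ℕ) : ℝ :=
  entropyBits (Finset.Icc 0 (2 * (q : ℤ) - 2)) (sumLaw (alphabet q) (alphabet q))
    - Real.logb 2 q

/-- Append zeros to (when `k₂ ≤ k₁`) a message of length `k₂` to get one of length `k₁`. -/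
def pad {q k₂ : ℕ} (k₁ : ℕ) (x : Fin k₂ → ZMod q) : Fin k₁ → ZMod q :=
  fun j => if h : (j : ℕ) < k₂ then x ⟨j, h⟩ else 0

/-- The larger code: all `G m` with `m` a message of length `k₁`. -/
def code₁ {q n k₁ : ℕ} (G : Matrix (Fin n) (Fin k₁) (ZMod q)) : Set (Fin n → ZMod q) :=
  Set.range fun m : Fin k₁ → ZMod q => G *ᵥ m

/-- The smaller code: all `G (x, 0)` with `x` a message of length `k₂`. -/
def code₂ {q n k₁ : ℕ} (k₂ : ℕ) (G : Matrix (Fin n) (Fin k₁) (ZMod q)) :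
    Set (Fin n → ZMod q) :=
  Set.range fun x : Fin k₂ → ZMod q => G *ᵥ pad k₁ x

/-- The coset `C ⊕ d` (addition modulo `q`). -/
def coset {q n : ℕ} (C : Set (Fin n → ZMod q)) (d : Fin n → ZMod q) : Set (Fin n → ZMod q) :=
  (fun t => t + d) '' C

/-- A set of vectors over `𝔽_q`, viewed as a set of integer vectors with entries
in `{0, …, q - 1}`. -/
def toInt {q n : ℕ} (C : Set (Fin n → ZMod q)) : Set (Fin n → ℤ) :=
  (fun x i => ((x i).val : ℤ)) '' C

/-- `a` equals `X` up to a factor `2 ^ (± n ε)`. The relation `a ≐ X` between sequences means that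
this holds at every `n`, with some `ε = ε n` that decreases to zero. -/
def DotEqAt (ε : ℝ) (n : ℕ) (a X : ℝ) : Prop :=
  X * (2 : ℝ) ^ (-((n : ℝ) * ε)) ≤ a ∧ a ≤ X * (2 : ℝ) ^ ((n : ℝ) * ε)

/-- `K` is a subset of `A + B` which contains `T₁ + T₂` with probability at least `1 - η`, whose
size is `≐ min {2 ^ (n (R₁ + R₂)), 2 ^ (n (max R₁ R₂ + D q))}` up to `2 ^ (± n ε)`, and each of
whose elements has probability
`≐ max {2 ^ (-n (R₁ + R₂)), 2 ^ (-n (max R₁ R₂ + D q))}` up to `2 ^ (± n ε)`.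
Here `T₁, T₂` are independent and uniform on `A`, `B`. -/
structure IsNormalTypical (q : ℕ) (R₁ R₂ ε η : ℝ) {n : ℕ} (A B K : Set (Fin n → ℤ)) : Prop where
  subset : K ⊆ A + B
  typical : 1 - η ≤ (sumLaw A B).real K
  size : DotEqAt ε n (K.ncard : ℝ)
    (min ((2 : ℝ) ^ ((n : ℝ) * (R₁ + R₂))) ((2 : ℝ) ^ ((n : ℝ) * (max R₁ R₂ + D q))))
  aep : ∀ w ∈ K, DotEqAt ε n ((sumLaw A B).real {w})
    (max ((2 : ℝ) ^ (-((n : ℝ) * (R₁ + R₂)))) ((2 : ℝ) ^ (-((n : ℝ) * (max R₁ R₂ + D q)))))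

end TypicalSumset

end

/-! Everything reduces to counting. Message pairs map to codeword pairs with fibres of equal size,
so `P_S(w)` is the number of message pairs whose codewords sum to `w`, divided by `q ^ k₁ * q ^ k₂`
(`sumLaw_code`). For most pairs this number, `msgMult`, must be about `max {1, 2 ^ (n (R₂ - D))}`.

Codewords of linearly independent messages are independent and uniform over the choice of `G`. A
uniform pair of vectors is typical: by Chebyshev, its integer sum has `2 ^ (n (log q - D ± δ))`
representations in `𝔽_q ^ n × 𝔽_q ^ n` (`card_not_isTypicalPair_le`), since the mean of the
log-multiplicity of a letter sum is `2 log q - H(U₁ + U₂)`.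

Upper bound: two representations of one integer sum agree modulo `q`, so up to the kernel of `G`
they differ by moving a codeword of the smaller code from one summand to the other (`msgMult_le`).
The kernel has bounded mean size. A uniform shift preserves a typical sum with probability at most
`2 ^ (-n (D - δ))`, which leaves on average about `q ^ k₂ * 2 ^ (-n D)` shifts plus a bounded number
from dependent messages (`sum_typical_shiftMult_le`).

Lower bound: a count of 1 is trivial. There are at most `2 ^ (n (log q + D + δ))` typical sums, each
congruent to a word of the coset with probability about `q ^ (k₁ - n)`, so about `2 ^ (n (R₁ + D))`
sums are available. The pairs lying over sums with too few representations are therefore a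
negligible fraction (`sum_ind_msgMult_lt_le`).

If `R₂ = 0`, independent messages need not dominate, but then `1 ≤ msgMult ≤ kerCard * q ^ k₂` is
already subexponential in probability. Markov's inequality over `G` and a diagonal choice of scale
(`exists_antitone_scale`) finish the argument. -/

namespace TypicalSumset

/-! ### Uniformity and independence of random codewords -/

open Classical in
-- All fibres of a homomorphism over its range are cosets of the kernel, so a surjection carries the
-- uniform distribution to the uniform distribution.
theorem sum_comp_of_surjective {A B : Type*} [AddGroup A] [AddGroup B] [Fintype A] [Fintype B]
    (φ : A →+ B) (hφ : Function.Surjective φ) (f : B → ℝ) :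
    ∑ a, f (φ a) = Fintype.card A * (∑ b, f b) / Fintype.card B := by
  have hfib : ∀ b, (Finset.univ.filter fun a => φ a = b).card
      = (Finset.univ.filter fun a => φ a = 0).card := fun b =>
    AddMonoidHom.card_fiber_eq_of_mem_range φ (hφ b) (hφ 0)
  set c := (Finset.univ.filter fun a => φ a = 0).card with hc
  have hcard : Fintype.card A = Fintype.card B * c := by
    have := Finset.card_eq_sum_card_fiberwise (s := (Finset.univ : Finset A))
      (t := (Finset.univ : Finset B)) (f := φ) (fun _ _ => by simp)
    rw [Finset.card_univ] at this
    rw [this, Finset.sum_congr rfl (fun b _ => hfib b)]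
    simp
  have hsum : ∑ a, f (φ a) = c * ∑ b, f b := by
    rw [← Finset.sum_fiberwise (s := Finset.univ) (g := φ), Finset.mul_sum]
    refine Finset.sum_congr rfl fun b _ => ?_
    rw [Finset.sum_congr rfl (g := fun _ => f b)
      (fun a ha => by rw [(Finset.mem_filter.1 ha).2]), Finset.sum_const, hfib b, nsmul_eq_mul]
  have : (Fintype.card B : ℝ) ≠ 0 := by
    have : Nonempty B := ⟨0⟩
    exact_mod_cast Fintype.card_ne_zero
  rw [hsum, hcard]
  field_simp
  push_cast
  ring

/-- Surjectivity of `G ↦ (G u_j)_j`, which makes the images of independent vectors jointly uniform.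
A left inverse of the injective map `c ↦ ∑ c_j u_j` recovers the coordinates, which are then sent to
the `v_j`. -/
theorem exists_mulVec_eq {K : Type*} [Field K] {n k r : ℕ} {u : Fin r → Fin k → K}
    (hu : LinearIndependent K u) (v : Fin r → Fin n → K) :
    ∃ G : Matrix (Fin n) (Fin k) K, ∀ j, G *ᵥ u j = v j := by
  have hinj : LinearMap.ker (Fintype.linearCombination K u) = ⊥ :=
    LinearMap.ker_eq_bot.2 (linearIndependent_iff_injective_fintypeLinearCombination.1 hu)
  obtain ⟨g, hg⟩ := LinearMap.exists_leftInverse_of_injective _ hinj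
  refine ⟨LinearMap.toMatrix' ((Fintype.linearCombination K v).comp g), fun j => ?_⟩
  rw [LinearMap.toMatrix'_mulVec, LinearMap.comp_apply]
  have h1 : g (u j) = Pi.single j 1 := by
    have := LinearMap.congr_fun hg (Pi.single j 1)
    simpa [Fintype.linearCombination_apply_single] using this
  rw [h1, Fintype.linearCombination_apply_single, one_smul]

section Uniformity

variable {q : ℕ} [Fact q.Prime] {n k : ℕ}

theorem card_vec (q : ℕ) [Fact q.Prime] (n : ℕ) :
    (Fintype.card (Fin n → ZMod q) : ℝ) = (q : ℝ) ^ n := by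
  simp [ZMod.card]

theorem sum_mulVec_one {u : Fin k → ZMod q} (hu : u ≠ 0) (f : (Fin n → ZMod q) → ℝ) :
    ∑ G : Matrix (Fin n) (Fin k) (ZMod q), f (G *ᵥ u)
      = Fintype.card (Matrix (Fin n) (Fin k) (ZMod q)) * (∑ s, f s) / (q : ℝ) ^ n := by
  have h := sum_comp_of_surjective
    (AddMonoidHom.mk' (fun G : Matrix (Fin n) (Fin k) (ZMod q) => G *ᵥ u)
      (fun G H => Matrix.add_mulVec G H u)) (fun v => by
        have hl : LinearIndependent (ZMod q) ![u] := by
          simpa using hu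
        obtain ⟨G, hG⟩ := exists_mulVec_eq hl ![v]
        exact ⟨G, by simpa using hG 0⟩) f
  rw [card_vec] at h
  exact h

theorem sum_mulVec_two {u₁ u₂ : Fin k → ZMod q} (hu : LinearIndependent (ZMod q) ![u₁, u₂])
    (f : (Fin n → ZMod q) × (Fin n → ZMod q) → ℝ) :
    ∑ G : Matrix (Fin n) (Fin k) (ZMod q), f (G *ᵥ u₁, G *ᵥ u₂)
      = Fintype.card (Matrix (Fin n) (Fin k) (ZMod q)) * (∑ s, f s)
        / ((q : ℝ) ^ n * (q : ℝ) ^ n) := by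
  have h := sum_comp_of_surjective
    (AddMonoidHom.mk' (fun G : Matrix (Fin n) (Fin k) (ZMod q) => (G *ᵥ u₁, G *ᵥ u₂))
      (fun G H => by simp [Matrix.add_mulVec])) (fun v => by
        obtain ⟨G, hG⟩ := exists_mulVec_eq hu ![v.1, v.2]
        exact ⟨G, Prod.ext (by simpa using hG 0) (by simpa using hG 1)⟩) f
  rw [Fintype.card_prod, Nat.cast_mul, card_vec] at h
  exact h

theorem sum_mulVec_three {u₁ u₂ u₃ : Fin k → ZMod q}
    (hu : LinearIndependent (ZMod q) ![u₁, u₂, u₃])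
    (f : (Fin n → ZMod q) × (Fin n → ZMod q) × (Fin n → ZMod q) → ℝ) :
    ∑ G : Matrix (Fin n) (Fin k) (ZMod q), f (G *ᵥ u₁, G *ᵥ u₂, G *ᵥ u₃)
      = Fintype.card (Matrix (Fin n) (Fin k) (ZMod q)) * (∑ s, f s)
        / ((q : ℝ) ^ n * ((q : ℝ) ^ n * (q : ℝ) ^ n)) := by
  have h := sum_comp_of_surjective
    (AddMonoidHom.mk' (fun G : Matrix (Fin n) (Fin k) (ZMod q) => (G *ᵥ u₁, G *ᵥ u₂, G *ᵥ u₃))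
      (fun G H => by simp [Matrix.add_mulVec])) (fun v => by
        obtain ⟨G, hG⟩ := exists_mulVec_eq hu ![v.1, v.2.1, v.2.2]
        exact ⟨G, Prod.ext (by simpa using hG 0)
          (Prod.ext (by simpa using hG 1) (by simpa using hG 2))⟩) f
  rw [Fintype.card_prod, Fintype.card_prod, Nat.cast_mul, Nat.cast_mul, card_vec] at h
  exact h

end Uniformity

/-! ### Second moments and Chebyshev's inequality, in counting form -/

theorem sum_sum_pi {X : Type*} [Fintype X] {g : X → ℝ} (hg : ∑ x, g x = 0) (n : ℕ) :
    ∑ z : Fin n → X, ∑ i, g (z i) = 0 := by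
  induction n with
  | zero => simp
  | succ n ih =>
    rw [← (Fin.consEquiv fun _ => X).sum_comp, Fintype.sum_prod_type]
    simp [Fin.consEquiv, Fin.sum_univ_succ, Finset.sum_add_distrib, ih, ← Finset.mul_sum, hg]

/-- Additivity of variance: cross terms vanish because `g` has mean zero. The factor `Fintype.card
X` on the left avoids the exponent `n - 1`. -/
theorem sum_sq_sum_pi {X : Type*} [Fintype X] {g : X → ℝ} (hg : ∑ x, g x = 0) (n : ℕ) :
    (∑ z : Fin n → X, (∑ i, g (z i)) ^ 2) * Fintype.card X
      = n * (Fintype.card X : ℝ) ^ n * ∑ x, g x ^ 2 := by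
  induction n with
  | zero => simp
  | succ n ih =>
    rw [← (Fin.consEquiv fun _ => X).sum_comp, Fintype.sum_prod_type]
    have h : ∀ x : X, ∑ z : Fin n → X, (g x + ∑ i, g (z i)) ^ 2
        = (Fintype.card X : ℝ) ^ n * g x ^ 2 + ∑ z : Fin n → X, (∑ i, g (z i)) ^ 2 := by
      intro x
      simp_rw [add_sq, Finset.sum_add_distrib, ← Finset.mul_sum, sum_sum_pi hg]
      simp
    simp only [Fin.consEquiv, Equiv.coe_fn_mk, Fin.sum_univ_succ, Fin.cons_zero, Fin.cons_succ, h,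
      Finset.sum_add_distrib, ← Finset.mul_sum, Finset.sum_const, Finset.card_univ, nsmul_eq_mul]
    rw [add_mul, mul_assoc (Fintype.card X : ℝ), mul_comm (Fintype.card X : ℝ), ih]
    push_cast
    ring

open Classical in
theorem card_deviation_le {X : Type*} [Fintype X] [Nonempty X] {g : X → ℝ}
    (hg : ∑ x, g x = 0) {n : ℕ} (hn : 0 < n) {δ : ℝ} (hδ : 0 < δ) :
    ((Finset.univ.filter fun z : Fin n → X => n * δ < |∑ i, g (z i)|).card : ℝ)
      ≤ (Fintype.card X : ℝ) ^ n * ((∑ x, g x ^ 2) / (n * δ ^ 2)) := by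
  have hn' : (0 : ℝ) < n := by exact_mod_cast hn
  have hX : (1 : ℝ) ≤ Fintype.card X := by exact_mod_cast Fintype.card_pos
  have h1 : ((Finset.univ.filter fun z : Fin n → X => n * δ < |∑ i, g (z i)|).card : ℝ)
      * (n * δ) ^ 2 ≤ ∑ z : Fin n → X, (∑ i, g (z i)) ^ 2 := by
    rw [← nsmul_eq_mul]
    refine (Finset.card_nsmul_le_sum _ (fun z : Fin n → X => (∑ i, g (z i)) ^ 2) _ ?_).trans
      (Finset.sum_le_sum_of_subset_of_nonneg (Finset.filter_subset _ _)
        fun _ _ _ => sq_nonneg _)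
    intro z hz
    rw [← sq_abs (∑ i, g (z i))]
    have := (Finset.mem_filter.1 hz).2
    gcongr
  have h2 : ∑ z : Fin n → X, (∑ i, g (z i)) ^ 2
      ≤ n * (Fintype.card X : ℝ) ^ n * ∑ x, g x ^ 2 := by
    rw [← sum_sq_sum_pi hg]
    exact le_mul_of_one_le_right (Finset.sum_nonneg fun _ _ => sq_nonneg _) hX
  rw [← mul_div_assoc, le_div_iff₀ (by positivity)]
  have h3 := h1.trans h2
  have : (n : ℝ) * (((Finset.univ.filter fun z : Fin n → X =>
      n * δ < |∑ i, g (z i)|).card : ℝ) * (n * δ ^ 2))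
      ≤ n * ((Fintype.card X : ℝ) ^ n * ∑ x, g x ^ 2) := by
    calc _ = _ := by ring
      _ ≤ _ := h3
      _ = _ := by ring
  exact le_of_mul_le_mul_left this hn'

/-! ### Laws of sums and of random matrices as normalized counts -/

section Law

variable {X Y V : Type*} [Fintype X] [Fintype Y]

open Classical in
theorem uniformOn_range [Nonempty X] [MeasurableSpace X] [DiscreteMeasurableSpace X]
    [MeasurableSpace V] [Countable V] [MeasurableSingletonClass V] {φ : X → V}
    (hφ : ∀ x y, (Finset.univ.filter fun z => φ z = φ x).card
      = (Finset.univ.filter fun z => φ z = φ y).card) :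
    uniformOn (Set.range φ) = (uniformOn (Set.univ : Set X)).map φ := by
  have hm : Measurable φ := Measurable.of_discrete
  refine Measure.ext_of_singleton fun v => ?_
  rw [Measure.map_apply hm (measurableSet_singleton v), uniformOn_univ]
  have hpre : φ ⁻¹' {v} = ((Finset.univ.filter fun z => φ z = v : Finset X) : Set X) := by
    ext z; simp
  have hr : Set.range φ = ((Finset.univ.image φ : Finset V) : Set V) := by ext; simp
  have hv : ({v} : Set V) = (({v} : Finset V) : Set V) := by simp
  rw [hpre, Measure.count_apply_finset, hr, hv, uniformOn_apply_finset]
  by_cases h : ∃ x, φ x = v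
  · obtain ⟨x, rfl⟩ := h
    have hint : (Finset.univ.image φ ∩ {φ x} : Finset V) = {φ x} := by ext; simp
    have hcard : Fintype.card X
        = (Finset.univ.image φ).card * (Finset.univ.filter fun z => φ z = φ x).card := by
      rw [← Finset.card_univ, Finset.card_eq_sum_card_image φ, Finset.sum_const_nat]
      intro w hw
      obtain ⟨y, -, rfl⟩ := Finset.mem_image.1 hw
      exact hφ y x
    have hc : (Finset.univ.filter fun z => φ z = φ x).card ≠ 0 :=
      Finset.card_ne_zero_of_mem (a := x) (by simp)
    rw [hint, hcard, Finset.card_singleton, Nat.cast_mul, Nat.cast_one]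
    rw [mul_comm, ← ENNReal.mul_div_mul_left 1 _ (c := ((Finset.univ.filter fun z => φ z = φ x).card : ENNReal))
      (by exact_mod_cast hc) (ENNReal.natCast_ne_top _), mul_one]
  · have h1 : (Finset.univ.image φ ∩ {v} : Finset V) = ∅ := by
      ext w
      simp only [Finset.mem_inter, Finset.mem_image, Finset.mem_singleton, Finset.notMem_empty,
        iff_false]
      rintro ⟨⟨x, -, hx⟩, rfl⟩
      exact h ⟨x, hx⟩
    have h2 : (Finset.univ.filter fun z => φ z = v) = ∅ := by
      ext x
      simpa using fun hx => h ⟨x, hx⟩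
    rw [h1, h2]
    simp

theorem uniformOn_univ_prod [Nonempty X] [Nonempty Y] [MeasurableSpace X]
    [DiscreteMeasurableSpace X] [MeasurableSpace Y] [DiscreteMeasurableSpace Y] :
    (uniformOn (Set.univ : Set X)).prod (uniformOn (Set.univ : Set Y))
      = uniformOn (Set.univ : Set (X × Y)) := by
  refine Measure.ext_of_singleton fun ⟨x, y⟩ => ?_
  rw [← Set.singleton_prod_singleton, Measure.prod_prod, uniformOn_univ, uniformOn_univ,
    uniformOn_univ, Set.singleton_prod_singleton]
  simp only [Measure.count_singleton, Fintype.card_prod, Nat.cast_mul, one_div]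
  rw [ENNReal.mul_inv] <;> simp

open Classical in
theorem sumLaw_range [Nonempty X] [Nonempty Y] [AddCommGroup V] [MeasurableSpace V] [Countable V]
    [MeasurableSingletonClass V] {φ : X → V} {ψ : Y → V}
    (hφ : ∀ x y, (Finset.univ.filter fun z => φ z = φ x).card
      = (Finset.univ.filter fun z => φ z = φ y).card)
    (hψ : ∀ x y, (Finset.univ.filter fun z => ψ z = ψ x).card
      = (Finset.univ.filter fun z => ψ z = ψ y).card) (E : Set V) :
    (sumLaw (Set.range φ) (Set.range ψ)).real E
      = ((Finset.univ.filter fun p : X × Y => φ p.1 + ψ p.2 ∈ E).card : ℝ)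
        / (Fintype.card X * Fintype.card Y) := by
  let : MeasurableSpace X := ⊤
  let : MeasurableSpace Y := ⊤
  have : DiscreteMeasurableSpace X := ⟨fun _ => trivial⟩
  have : DiscreteMeasurableSpace Y := ⟨fun _ => trivial⟩
  have hφm : Measurable φ := Measurable.of_discrete
  have hψm : Measurable ψ := Measurable.of_discrete
  have hE : MeasurableSet E := E.to_countable.measurableSet
  have hadd : Measurable fun p : V × V => p.1 + p.2 :=
    Measurable.of_discrete
  rw [sumLaw, uniformOn_range hφ, uniformOn_range hψ, Measure.map_prod_map _ _ hφm hψm,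
    Measure.map_map hadd (by fun_prop), uniformOn_univ_prod, measureReal_def,
    Measure.map_apply Measurable.of_discrete hE, uniformOn_univ]
  have hpre : ((fun p : V × V => p.1 + p.2) ∘ Prod.map φ ψ) ⁻¹' E
      = ((Finset.univ.filter fun p : X × Y => φ p.1 + ψ p.2 ∈ E : Finset (X × Y)) :
        Set (X × Y)) := by
    ext; simp
  rw [hpre, Measure.count_apply_finset]
  simp

end Law

section RandomMatrix

open Classical in
-- Independent uniform entries give every matrix the same probability, so from here on averages over
-- `G` are finite sums.
theorem prob_matrix_mem {q n k : ℕ} [Fact q.Prime] {Ω : Type*} [MeasurableSpace Ω]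
    {P : Measure Ω} [IsProbabilityMeasure P] {G : Ω → Matrix (Fin n) (Fin k) (ZMod q)}
    (hG_meas : ∀ (i : Fin n) (j : Fin k) (a : ZMod q), MeasurableSet {ω | G ω i j = a})
    (hG_unif : ∀ (i : Fin n) (j : Fin k) (a : ZMod q),
      P {ω | G ω i j = a} = (q : ENNReal)⁻¹)
    (hG_indep : iIndepFun (m := fun _ => ⊤)
      (fun (p : Fin n × Fin k) (ω : Ω) => G ω p.1 p.2) P)
    (S : Matrix (Fin n) (Fin k) (ZMod q) → Prop) :
    P {ω | S (G ω)} = ENNReal.ofReal (((Finset.univ.filter S).card : ℝ)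
      / Fintype.card (Matrix (Fin n) (Fin k) (ZMod q))) := by
  have hset : ∀ g : Matrix (Fin n) (Fin k) (ZMod q),
      {ω | G ω = g} = ⋂ p ∈ (Finset.univ : Finset (Fin n × Fin k)),
        (fun ω => G ω p.1 p.2) ⁻¹' {g p.1 p.2} := by
    intro g
    ext ω
    simp only [Set.mem_ofPred_eq, Finset.mem_univ, Set.iInter_true, Set.mem_iInter,
      Set.mem_preimage, Set.mem_singleton_iff, Prod.forall]
    exact ⟨fun h i j => by rw [h], fun h => by ext i j; exact h i j⟩
  have hmeas : ∀ g, MeasurableSet {ω | G ω = g} := by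
    intro g
    rw [hset]
    exact Finset.measurableSet_biInter _ fun p _ => hG_meas p.1 p.2 _
  have hcardM : Fintype.card (Matrix (Fin n) (Fin k) (ZMod q)) = q ^ (n * k) := by
    rw [Fintype.card_congr Matrix.of.symm]
    simp [ZMod.card, ← pow_mul, mul_comm]
  have hq : (q : ENNReal) ≠ 0 := by exact_mod_cast (Fact.out : q.Prime).ne_zero
  have hprob : ∀ g, P {ω | G ω = g}
      = (Fintype.card (Matrix (Fin n) (Fin k) (ZMod q)) : ENNReal)⁻¹ := by
    intro g
    rw [hset, hG_indep.measure_inter_preimage_eq_mul Finset.univ (fun _ _ => trivial)]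
    have : ∀ p : Fin n × Fin k, P ((fun ω => G ω p.1 p.2) ⁻¹' {g p.1 p.2}) = (q : ENNReal)⁻¹ :=
      fun p => hG_unif p.1 p.2 _
    simp only [this, Finset.prod_const, hcardM, Finset.card_univ, Fintype.card_prod,
      Fintype.card_fin]
    rw [Nat.cast_pow, ENNReal.inv_pow]
  have hun : {ω | S (G ω)} = ⋃ g ∈ Finset.univ.filter S, {ω | G ω = g} := by
    ext ω
    simp
  rw [hun, measure_biUnion_finset]
  · simp only [hprob, Finset.sum_const, nsmul_eq_mul]
    rw [ENNReal.ofReal_div_of_pos (by exact_mod_cast Fintype.card_pos), ENNReal.ofReal_natCast,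
      ENNReal.ofReal_natCast, div_eq_mul_inv]
  · intro g _ h _ hgh
    exact Set.disjoint_left.2 fun ω h1 h2 => hgh (h1.symm.trans h2)
  · exact fun g _ => hmeas g

end RandomMatrix

/-! ### Diagonal choice of a scale -/

/-- A quantitative property which holds asymptotically almost surely at every fixed scale
also holds along some scale decreasing to zero. -/
theorem exists_antitone_scale {p : ℕ → ℝ → ENNReal} (hp : ∀ n x, p n x ≤ 1)
    (h : ∀ x, 0 < x → Tendsto (fun n => p n x) atTop (𝓝 1)) :
    ∃ e : ℕ → ℝ, Antitone e ∧ Tendsto e atTop (𝓝 0) ∧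
      Tendsto (fun n => p n (e n)) atTop (𝓝 1) := by
  classical
  have h1 : ∀ j : ℕ, ∃ N, ∀ n ≥ N, 1 - ((j : ENNReal) + 1)⁻¹ ≤ p n (1 / ((j : ℝ) + 1)) := by
    intro j
    have hlt : 1 - ((j : ENNReal) + 1)⁻¹ < 1 := by
      refine ENNReal.sub_lt_self ENNReal.one_ne_top one_ne_zero ?_
      simp
    have := (h (1 / ((j : ℝ) + 1)) (by positivity)).eventually (lt_mem_nhds hlt)
    obtain ⟨N, hN⟩ := eventually_atTop.1 this
    exact ⟨N, fun n hn => (hN n hn).le⟩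
  choose N hN using h1
  -- `J n` is the finest scale whose threshold has been passed by time `n`; the search bound `j ≤ n`
  -- only keeps it finite. The default value 0 can fail the condition when `n < N 0`, hence the
  -- restriction in `hJspec`.
  let J : ℕ → ℕ := fun n => Nat.findGreatest (fun j => N j ≤ n) n
  have hJmono : Monotone J := fun a b hab =>
    Nat.findGreatest_mono (fun j (hj : N j ≤ a) => hj.trans hab) hab
  have hJtop : Tendsto J atTop atTop := by
    refine tendsto_atTop.2 fun b => ?_
    filter_upwards [eventually_ge_atTop (max b (N b))] with n hn
    exact Nat.le_findGreatest ((le_max_left _ _).trans hn) ((le_max_right _ _).trans hn)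
  have hJspec : ∀ n ≥ N 0, N (J n) ≤ n := fun n hn =>
    Nat.findGreatest_spec (P := fun j => N j ≤ n) (Nat.zero_le n) hn
  refine ⟨fun n => 1 / ((J n : ℝ) + 1), ?_, ?_, ?_⟩
  · intro a b hab
    have : (J a : ℝ) ≤ J b := by exact_mod_cast hJmono hab
    dsimp only
    gcongr
  · exact tendsto_one_div_add_atTop_nhds_zero_nat.comp hJtop
  · have hlow : Tendsto (fun n => 1 - ((J n : ENNReal) + 1)⁻¹) atTop (𝓝 1) := by
      have h2 : Tendsto (fun j : ℕ => ((j : ENNReal) + 1)⁻¹) atTop (𝓝 0) := by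
        have := ENNReal.tendsto_inv_nat_nhds_zero.comp (tendsto_add_atTop_nat 1)
        refine this.congr fun j => ?_
        simp
      have h3 := ENNReal.Tendsto.sub (tendsto_const_nhds (x := (1 : ENNReal)) (f := atTop)) h2
        (Or.inl ENNReal.one_ne_top)
      rw [tsub_zero] at h3
      exact h3.comp hJtop
    refine tendsto_of_tendsto_of_tendsto_of_le_of_le' hlow tendsto_const_nhds ?_
      (Eventually.of_forall fun n => hp _ _)
    filter_upwards [eventually_ge_atTop (N 0)] with n hn
    exact hN _ _ (hJspec n hn)

/-! ### Representations of integer sums, and typical pairs -/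

/-- The sum of two vectors over `𝔽_q`, computed in the integers. -/
def intSum {q n : ℕ} (s t : Fin n → ZMod q) : Fin n → ℤ :=
  fun i => ((s i).val : ℤ) + ((t i).val : ℤ)

theorem intSum_cast {q n : ℕ} [NeZero q] (s t : Fin n → ZMod q) :
    (fun i => ((intSum s t i : ℤ) : ZMod q)) = s + t := by
  ext i
  simp [intSum]

open Classical in
/-- The number of pairs of letters with the same integer sum as `p`. -/
def letterMult (q : ℕ) [NeZero q] (p : ZMod q × ZMod q) : ℕ :=
  (Finset.univ.filter fun r : ZMod q × ZMod q =>
    (r.1.val : ℤ) + (r.2.val : ℤ) = (p.1.val : ℤ) + (p.2.val : ℤ)).card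

open Classical in
/-- The number of pairs of vectors with the same integer sum as `p`. -/
def vecMult {q n : ℕ} [NeZero q] (p : (Fin n → ZMod q) × (Fin n → ZMod q)) : ℕ :=
  (Finset.univ.filter fun r : (Fin n → ZMod q) × (Fin n → ZMod q) =>
    intSum r.1 r.2 = intSum p.1 p.2).card

theorem letterMult_pos {q : ℕ} [NeZero q] (p : ZMod q × ZMod q) : 0 < letterMult q p :=
  Finset.card_pos.2 ⟨p, by simp⟩

theorem vecMult_pos {q n : ℕ} [NeZero q] (p : (Fin n → ZMod q) × (Fin n → ZMod q)) :
    0 < vecMult p :=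
  Finset.card_pos.2 ⟨p, by simp⟩

open Classical in
theorem vecMult_eq_prod {q n : ℕ} [NeZero q] (p : (Fin n → ZMod q) × (Fin n → ZMod q)) :
    vecMult p = ∏ i, letterMult q (p.1 i, p.2 i) := by
  unfold vecMult letterMult
  rw [← Fintype.card_piFinset]
  refine Finset.card_equiv (Equiv.arrowProdEquivProdArrow _ _ _).symm fun r => ?_
  simp [Fintype.mem_piFinset, intSum, funext_iff, Equiv.arrowProdEquivProdArrow]

theorem logb_vecMult {q n : ℕ} [NeZero q] (p : (Fin n → ZMod q) × (Fin n → ZMod q)) :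
    Real.logb 2 (vecMult p) = ∑ i, Real.logb 2 (letterMult q (p.1 i, p.2 i)) := by
  rw [vecMult_eq_prod, Nat.cast_prod, Real.logb_prod]
  exact fun i _ => by exact_mod_cast (letterMult_pos _).ne'

open Classical in
-- This is where the entropy enters. Since `U₁ + U₂` takes the value `a` with probability `N a /
-- q²`, the mean of `log N (U₁ + U₂)` is `2 log q - H(U₁ + U₂) = log q - D q`.
theorem sum_logb_letterMult (q : ℕ) [NeZero q] :
    ∑ p, Real.logb 2 (letterMult q p) = (q : ℝ) * q * (Real.logb 2 q - D q) := by
  set N : ℤ → ℕ := fun a => (Finset.univ.filter fun r : ZMod q × ZMod q =>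
    (r.1.val : ℤ) + (r.2.val : ℤ) = a).card with hN
  have hq : (q : ℝ) ≠ 0 := by exact_mod_cast NeZero.ne q
  have halph : alphabet q = Set.range fun u : ZMod q => (u.val : ℤ) := by
    ext a
    simp only [alphabet, Set.mem_Ico, Set.mem_range]
    constructor
    · rintro ⟨h0, h1⟩
      lift a to ℕ using h0
      exact ⟨a, by rw [ZMod.val_natCast_of_lt (by exact_mod_cast h1)]⟩
    · rintro ⟨u, rfl⟩
      exact ⟨by positivity, by exact_mod_cast ZMod.val_lt u⟩
  have hfib : ∀ x y : ZMod q, (Finset.univ.filter fun z : ZMod q => (z.val : ℤ) = x.val).card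
      = (Finset.univ.filter fun z : ZMod q => (z.val : ℤ) = y.val).card := by
    have : ∀ x : ZMod q, (Finset.univ.filter fun z : ZMod q => (z.val : ℤ) = x.val) = {x} := by
      intro x
      ext z
      simp only [Nat.cast_inj, Finset.mem_filter, Finset.mem_univ, true_and,
        Finset.mem_singleton]
      exact (ZMod.val_injective q).eq_iff
    intro x y
    rw [this, this, Finset.card_singleton, Finset.card_singleton]
  have hlaw : ∀ a : ℤ, (sumLaw (alphabet q) (alphabet q)).real {a} = N a / (q * q) := by
    intro a
    rw [halph, sumLaw_range (fun x y => by convert hfib x y) (fun x y => by convert hfib x y)]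
    simp [hN, ZMod.card]
  have hmaps : ∀ r ∈ (Finset.univ : Finset (ZMod q × ZMod q)),
      (r.1.val : ℤ) + (r.2.val : ℤ) ∈ Finset.Icc (0 : ℤ) (2 * (q : ℤ) - 2) := by
    intro r _
    have h1 := ZMod.val_lt r.1
    have h2 := ZMod.val_lt r.2
    rw [Finset.mem_Icc]
    omega
  have hsumN : ∑ a ∈ Finset.Icc (0 : ℤ) (2 * (q : ℤ) - 2), (N a : ℝ) = q * q := by
    have := Finset.card_eq_sum_card_fiberwise hmaps
    rw [Finset.card_univ, Fintype.card_prod, ZMod.card] at this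
    exact_mod_cast this.symm
  have hlhs : ∑ p, Real.logb 2 (letterMult q p)
      = ∑ a ∈ Finset.Icc (0 : ℤ) (2 * (q : ℤ) - 2), (N a : ℝ) * Real.logb 2 (N a) := by
    rw [← Finset.sum_fiberwise_of_maps_to hmaps]
    refine Finset.sum_congr rfl fun a _ => ?_
    rw [← nsmul_eq_mul, ← Finset.sum_const]
    refine Finset.sum_congr rfl fun p hp => ?_
    rw [letterMult, (Finset.mem_filter.1 hp).2]
  have hterm : ∀ a : ℤ, (N a : ℝ) / (q * q) * Real.logb 2 ((N a : ℝ) / (q * q))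
      = (N a * Real.logb 2 (N a) - N a * (2 * Real.logb 2 q)) / (q * q) := by
    intro a
    rcases eq_or_ne (N a : ℝ) 0 with h | h
    · simp [h]
    · rw [Real.logb_div h (by positivity), Real.logb_mul hq hq]
      ring
  rw [D, entropyBits, hlhs]
  simp only [hlaw, hterm]
  rw [← Finset.sum_div, Finset.sum_sub_distrib, ← Finset.sum_mul, hsumN]
  field_simp
  ring

theorem letterMult_le (q : ℕ) [NeZero q] (p : ZMod q × ZMod q) : letterMult q p ≤ q := by
  classical
  unfold letterMult
  conv_rhs => rw [← ZMod.card q, ← Finset.card_univ]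
  refine Finset.card_le_card_of_injOn Prod.fst (fun _ _ => by simp) ?_
  intro r hr r' hr' h
  have h1 := (Finset.mem_filter.1 hr).2
  have h2 := (Finset.mem_filter.1 hr').2
  rw [h] at h1
  refine Prod.ext h (ZMod.val_injective q ?_)
  omega

/-- A letter sum is determined by its first summand, so each log-multiplicity, and hence their mean
`log q - D q`, is at most `log q`. -/
theorem D_nonneg (q : ℕ) [NeZero q] : 0 ≤ D q := by
  have hq : (0 : ℝ) < q := by exact_mod_cast NeZero.pos q
  have h : ∑ p, Real.logb 2 (letterMult q p) ≤ ∑ _p : ZMod q × ZMod q, Real.logb 2 q := by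
    refine Finset.sum_le_sum fun p _ => ?_
    refine Real.logb_le_logb_of_le one_lt_two ?_ (by exact_mod_cast letterMult_le q p)
    exact_mod_cast letterMult_pos p
  rw [sum_logb_letterMult, Finset.sum_const, Finset.card_univ, Fintype.card_prod, ZMod.card,
    nsmul_eq_mul, Nat.cast_mul] at h
  have := le_of_mul_le_mul_left h (by positivity)
  linarith

/-- A pair of vectors whose integer sum has about the expected number of representations. -/
def IsTypicalPair {q n : ℕ} [NeZero q] (δ : ℝ) (p : (Fin n → ZMod q) × (Fin n → ZMod q)) : Prop :=
  |Real.logb 2 (vecMult p) - n * (Real.logb 2 q - D q)| ≤ n * δ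

theorem IsTypicalPair.vecMult_le {q n : ℕ} [NeZero q] {δ : ℝ}
    {p : (Fin n → ZMod q) × (Fin n → ZMod q)} (h : IsTypicalPair δ p) :
    (vecMult p : ℝ) ≤ 2 ^ (n * (Real.logb 2 q - D q + δ)) := by
  rw [← Real.logb_le_iff_le_rpow one_lt_two (by exact_mod_cast vecMult_pos p)]
  have := (abs_le.1 h).2
  linarith

theorem IsTypicalPair.le_vecMult {q n : ℕ} [NeZero q] {δ : ℝ}
    {p : (Fin n → ZMod q) × (Fin n → ZMod q)} (h : IsTypicalPair δ p) :
    (2 : ℝ) ^ (n * (Real.logb 2 q - D q - δ)) ≤ vecMult p := by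
  rw [← Real.le_logb_iff_rpow_le one_lt_two (by exact_mod_cast vecMult_pos p)]
  have := (abs_le.1 h).1
  linarith

open Classical in
-- The log-multiplicity is additive over coordinates, so this is Chebyshev for the centred letter
-- log-multiplicity.
theorem card_not_isTypicalPair_le (q : ℕ) [NeZero q] : ∃ C : ℝ, ∀ (n : ℕ), 0 < n → ∀ δ : ℝ, 0 < δ →
    ((Finset.univ.filter fun p : (Fin n → ZMod q) × (Fin n → ZMod q) =>
      ¬ IsTypicalPair δ p).card : ℝ) ≤ (q : ℝ) ^ n * (q : ℝ) ^ n * (C / (n * δ ^ 2)) := by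
  set g : ZMod q × ZMod q → ℝ := fun x => Real.logb 2 (letterMult q x) - (Real.logb 2 q - D q)
    with hg
  have hg0 : ∑ x, g x = 0 := by
    rw [hg, Finset.sum_sub_distrib, sum_logb_letterMult]
    simp only [Finset.sum_const, Finset.card_univ, Fintype.card_prod, ZMod.card, nsmul_eq_mul,
      Nat.cast_mul]
    ring
  refine ⟨∑ x, g x ^ 2, fun n hn δ hδ => ?_⟩
  have h := card_deviation_le hg0 hn hδ
  rw [Fintype.card_prod, ZMod.card, Nat.cast_mul, mul_pow] at h
  refine le_trans (le_of_eq ?_) h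
  congr 1
  refine Finset.card_equiv (Equiv.arrowProdEquivProdArrow _ _ _).symm fun p => ?_
  simp [IsTypicalPair, logb_vecMult, hg, Equiv.arrowProdEquivProdArrow, Finset.sum_sub_distrib,
    mul_sub]

open Classical in
/-- The integer sums of typical pairs. -/
noncomputable def typicalSums (q n : ℕ) [NeZero q] (δ : ℝ) : Finset (Fin n → ℤ) :=
  (Finset.univ.filter fun p : (Fin n → ZMod q) × (Fin n → ZMod q) => IsTypicalPair δ p).image
    fun p => intSum p.1 p.2

open Classical in
-- Fibres over distinct sums are disjoint, and each typical one uses at least `2 ^ (n (log q - D q -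
-- δ))` of the `q ^ (2n)` pairs.
theorem card_typicalSums_le (q n : ℕ) [NeZero q] (δ : ℝ) :
    ((typicalSums q n δ).card : ℝ) ≤ 2 ^ (n * (Real.logb 2 q + D q + δ)) := by
  have hq : (0 : ℝ) < q := by exact_mod_cast NeZero.pos q
  have h1 : ((typicalSums q n δ).card : ℝ) * 2 ^ (n * (Real.logb 2 q - D q - δ))
      ≤ (q : ℝ) ^ n * (q : ℝ) ^ n := by
    have hfib : ∑ w ∈ typicalSums q n δ, ((Finset.univ.filter
        fun r : (Fin n → ZMod q) × (Fin n → ZMod q) => intSum r.1 r.2 = w).card : ℝ)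
        ≤ (q : ℝ) ^ n * (q : ℝ) ^ n := by
      have h := Finset.card_eq_sum_card_image
        (fun r : (Fin n → ZMod q) × (Fin n → ZMod q) => intSum r.1 r.2) Finset.univ
      rw [Finset.card_univ, Fintype.card_prod] at h
      have h' := congrArg (Nat.cast : ℕ → ℝ) h
      push_cast at h'
      simp only [Fintype.card_pi, ZMod.card, Finset.prod_const, Finset.card_univ,
        Fintype.card_fin, Nat.cast_pow] at h'
      rw [h']
      exact Finset.sum_le_sum_of_subset_of_nonneg
        (Finset.image_subset_image (Finset.filter_subset _ _)) fun _ _ _ => by positivity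
    refine le_trans ?_ hfib
    rw [← nsmul_eq_mul]
    refine Finset.card_nsmul_le_sum _ _ _ fun w hw => ?_
    obtain ⟨p, hp, rfl⟩ := Finset.mem_image.1 hw
    exact (Finset.mem_filter.1 hp).2.le_vecMult
  have h2 : (q : ℝ) ^ n * (q : ℝ) ^ n = 2 ^ (n * (Real.logb 2 q + D q + δ))
      * 2 ^ (n * (Real.logb 2 q - D q - δ)) := by
    rw [← Real.rpow_add two_pos]
    have : (q : ℝ) ^ n = 2 ^ (n * Real.logb 2 q) := by
      rw [mul_comm, Real.rpow_mul two_pos.le, Real.rpow_logb two_pos (by norm_num) hq,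
        Real.rpow_natCast]
    rw [this, ← Real.rpow_add two_pos]
    congr 1
    ring
  rw [h2] at h1
  exact le_of_mul_le_mul_right h1 (by positivity)

/-! ### Messages, and multiplicities of sums of codewords -/

section Padding

variable {q k₂ : ℕ}

theorem pad_add (k₁ : ℕ) (x y : Fin k₂ → ZMod q) : pad k₁ (x + y) = pad k₁ x + pad k₁ y := by
  ext j
  by_cases h : (j : ℕ) < k₂ <;> simp [pad, h]

theorem pad_zero (k₁ : ℕ) : pad k₁ (0 : Fin k₂ → ZMod q) = 0 := by
  ext j
  by_cases h : (j : ℕ) < k₂ <;> simp [pad, h]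

theorem pad_injective {k₁ : ℕ} (hk : k₂ ≤ k₁) :
    Function.Injective (pad k₁ : (Fin k₂ → ZMod q) → Fin k₁ → ZMod q) := by
  intro x y h
  ext j
  have := congrFun h ⟨j, j.2.trans_le hk⟩
  simpa [pad] using this

end Padding

section Messages

variable {q : ℕ} [Fact q.Prime] {n k₁ k₂ : ℕ}

/-- The integer sum of the codewords attached to a pair of messages. -/
def msgSum (G : Matrix (Fin n) (Fin k₁) (ZMod q)) (d : Fin n → ZMod q)
    (p : (Fin k₁ → ZMod q) × (Fin k₂ → ZMod q)) : Fin n → ℤ :=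
  intSum (G *ᵥ p.1 + d) (G *ᵥ pad k₁ p.2)

open Classical in
/-- The number of pairs of messages with the same integer sum of codewords as `p`. -/
noncomputable def msgMult (G : Matrix (Fin n) (Fin k₁) (ZMod q)) (d : Fin n → ZMod q)
    (p : (Fin k₁ → ZMod q) × (Fin k₂ → ZMod q)) : ℕ :=
  (Finset.univ.filter fun r : (Fin k₁ → ZMod q) × (Fin k₂ → ZMod q) =>
    msgSum G d r = msgSum G d p).card

open Classical in
/-- The number of messages in the kernel of `G`. -/
noncomputable def kerCard (G : Matrix (Fin n) (Fin k₁) (ZMod q)) : ℕ :=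
  (Finset.univ.filter fun v => G *ᵥ v = 0).card

open Classical in
/-- The number of codewords of the smaller code which can be moved from the first summand to
the second one without changing the integer sum. -/
noncomputable def shiftMult (G : Matrix (Fin n) (Fin k₁) (ZMod q)) (d : Fin n → ZMod q)
    (p : (Fin k₁ → ZMod q) × (Fin k₂ → ZMod q)) : ℕ :=
  (Finset.univ.filter fun y : Fin k₂ → ZMod q =>
    intSum (G *ᵥ p.1 + d - G *ᵥ pad k₁ y) (G *ᵥ pad k₁ p.2 + G *ᵥ pad k₁ y)
      = msgSum G d p).card

theorem msgMult_pos (G : Matrix (Fin n) (Fin k₁) (ZMod q)) (d : Fin n → ZMod q)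
    (p : (Fin k₁ → ZMod q) × (Fin k₂ → ZMod q)) : 0 < msgMult G d p :=
  Finset.card_pos.2 ⟨p, by simp⟩

theorem shiftMult_le (G : Matrix (Fin n) (Fin k₁) (ZMod q)) (d : Fin n → ZMod q)
    (p : (Fin k₁ → ZMod q) × (Fin k₂ → ZMod q)) : (shiftMult G d p : ℝ) ≤ (q : ℝ) ^ k₂ := by
  rw [← card_vec]
  exact_mod_cast Finset.card_le_univ _

open Classical in
-- Equal integer sums are equal modulo `q`. The change `y` in the second message therefore
-- determines the first codeword, and the first message up to the kernel of `G`.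
theorem msgMult_le (G : Matrix (Fin n) (Fin k₁) (ZMod q)) (d : Fin n → ZMod q)
    (p : (Fin k₁ → ZMod q) × (Fin k₂ → ZMod q)) :
    msgMult G d p ≤ kerCard G * shiftMult G d p := by
  unfold kerCard shiftMult
  rw [← Finset.card_product]
  refine Finset.card_le_card_of_injOn
    -- The first entry lies in the kernel; the second is the shift counted by `shiftMult`.
    (fun r => (r.1 - p.1 + pad k₁ (r.2 - p.2), r.2 - p.2)) ?_ ?_
  · intro r hr
    have hr' : msgSum G d r = msgSum G d p := by simpa using hr
    have hpad : pad k₁ p.2 + pad k₁ (r.2 - p.2) = pad k₁ r.2 := by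
      rw [← pad_add, add_sub_cancel]
    have hG : G *ᵥ pad k₁ p.2 + G *ᵥ pad k₁ (r.2 - p.2) = G *ᵥ pad k₁ r.2 := by
      rw [← Matrix.mulVec_add, hpad]
    have hmod : G *ᵥ r.1 + d + G *ᵥ pad k₁ r.2 = G *ᵥ p.1 + d + G *ᵥ pad k₁ p.2 := by
      have := congrArg (fun (w : Fin n → ℤ) i => ((w i : ℤ) : ZMod q)) hr'
      simpa only [msgSum, intSum_cast] using this
    have hker : G *ᵥ (r.1 - p.1 + pad k₁ (r.2 - p.2)) = 0 := by
      rw [Matrix.mulVec_add, Matrix.mulVec_sub, eq_sub_of_add_eq' hG, ← sub_eq_zero_of_eq hmod]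
      abel
    have hfst : G *ᵥ p.1 + d - G *ᵥ pad k₁ (r.2 - p.2) = G *ᵥ r.1 + d := by
      rw [eq_sub_of_add_eq' hG, sub_eq_iff_eq_add, ← add_sub_assoc, hmod]
      abel
    simp only [Finset.coe_product, Finset.coe_filter, Finset.mem_univ, true_and, Set.mem_prod,
      Set.mem_ofPred_eq]
    refine ⟨hker, ?_⟩
    rw [hfst, hG]
    exact hr'
  · intro r _ r' _ h
    have h2 : r.2 - p.2 = r'.2 - p.2 := (Prod.ext_iff.1 h).2
    have h1 := (Prod.ext_iff.1 h).1
    dsimp only at h1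
    rw [h2] at h1
    exact Prod.ext (sub_left_injective (add_right_cancel h1)) (sub_left_injective h2)

open Classical in
theorem card_fiber_mulVec_eq {k : ℕ} (A : (Fin k → ZMod q) →+ (Fin n → ZMod q))
    (d : Fin n → ZMod q) (x y : Fin k → ZMod q) :
    (Finset.univ.filter fun z => (fun i => (((A z + d) i).val : ℤ))
        = fun i => (((A x + d) i).val : ℤ)).card
      = (Finset.univ.filter fun z => (fun i => (((A z + d) i).val : ℤ))
        = fun i => (((A y + d) i).val : ℤ)).card := by
  have hiff : ∀ x z, ((fun i => (((A z + d) i).val : ℤ)) = fun i => (((A x + d) i).val : ℤ))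
      ↔ A z = A x := by
    intro x z
    constructor
    · intro h
      refine add_right_cancel (b := d) (funext fun i => ZMod.val_injective q ?_)
      exact_mod_cast congrFun h i
    · intro h
      rw [h]
  simp only [hiff]
  exact AddMonoidHom.card_fiber_eq_of_mem_range A ⟨x, rfl⟩ ⟨y, rfl⟩

open Classical in
-- Encoding is affine, so its fibres have equal size and uniform messages give uniform codewords
-- even when `G` is not injective.
theorem sumLaw_code (G : Matrix (Fin n) (Fin k₁) (ZMod q)) (d : Fin n → ZMod q)
    (E : Set (Fin n → ℤ)) :
    (sumLaw (toInt (coset (code₁ G) d)) (toInt (code₂ k₂ G))).real E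
      = ((Finset.univ.filter fun p : (Fin k₁ → ZMod q) × (Fin k₂ → ZMod q) =>
          msgSum G d p ∈ E).card : ℝ) / ((q : ℝ) ^ k₁ * (q : ℝ) ^ k₂) := by
  let A : (Fin k₁ → ZMod q) →+ (Fin n → ZMod q) :=
    AddMonoidHom.mk' (fun m => G *ᵥ m) fun x y => Matrix.mulVec_add G x y
  let B : (Fin k₂ → ZMod q) →+ (Fin n → ZMod q) :=
    AddMonoidHom.mk' (fun x => G *ᵥ pad k₁ x) fun x y => by
      rw [pad_add, Matrix.mulVec_add]
  have h1 : toInt (coset (code₁ G) d) = Set.range fun m => fun i => (((A m + d) i).val : ℤ) := by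
    simp only [toInt, coset, code₁, ← Set.range_comp]
    rfl
  have h2 : toInt (code₂ k₂ G) = Set.range fun x => fun i => (((B x + 0) i).val : ℤ) := by
    simp only [toInt, code₂, ← Set.range_comp, add_zero]
    rfl
  have h := sumLaw_range (φ := fun m => fun i => (((A m + d) i).val : ℤ))
    (ψ := fun x => fun i => (((B x + 0) i).val : ℤ))
    (fun x y => by convert card_fiber_mulVec_eq A d x y)
    (fun x y => by convert card_fiber_mulVec_eq B 0 x y) E
  rw [← h1, ← h2, card_vec, card_vec] at h
  rw [h]
  congr 3
  ext p
  simp only [add_zero]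
  rfl

end Messages

/-! ### Averages over the random matrix -/

open Classical in
/-- The indicator of a proposition, as a real number. -/
noncomputable def ind (p : Prop) : ℝ := if p then 1 else 0

theorem ind_of_true {p : Prop} (h : p) : ind p = 1 := by simp [ind, h]

theorem ind_nonneg (p : Prop) : 0 ≤ ind p := by
  unfold ind; split_ifs <;> norm_num

theorem ind_le_one (p : Prop) : ind p ≤ 1 := by
  unfold ind; split_ifs <;> norm_num

theorem ind_mono {p r : Prop} (h : p → r) : ind p ≤ ind r := by
  by_cases hp : p
  · rw [ind_of_true hp, ind_of_true (h hp)]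
  · simpa [ind, hp] using ind_nonneg r

theorem ind_and (p r : Prop) : ind (p ∧ r) = ind p * ind r := by
  by_cases hp : p <;> by_cases hr : r <;> simp [ind, hp, hr]

theorem sum_ind {X : Type*} [Fintype X] (S : X → Prop) [DecidablePred S] :
    ∑ x, ind (S x) = ((Finset.univ.filter S).card : ℝ) := by
  classical
  rw [Finset.card_filter, Nat.cast_sum]
  refine Finset.sum_congr rfl fun x _ => ?_
  by_cases h : S x <;> simp [ind, h]

theorem ind_lt_le_div {a b : ℝ} (hb : 0 < b) (ha : 0 ≤ a) : ind (b < a) ≤ a / b := by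
  by_cases h : b < a
  · rw [ind_of_true h, one_le_div hb]
    exact h.le
  · simp only [ind, h, if_false]
    positivity

section Averages

variable {q : ℕ} [Fact q.Prime] {n k₁ k₂ : ℕ}

/-- The number of matrices. -/
noncomputable def matCard (q n k : ℕ) [Fact q.Prime] : ℝ :=
  (Fintype.card (Matrix (Fin n) (Fin k) (ZMod q)) : ℝ)

theorem matCard_pos (q n k : ℕ) [Fact q.Prime] : 0 < matCard q n k :=
  Nat.cast_pos.2 Fintype.card_pos

theorem sum_le_matCard {f : Matrix (Fin n) (Fin k₁) (ZMod q) → ℝ} {c : ℝ} (h : ∀ G, f G ≤ c) :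
    ∑ G, f G ≤ matCard q n k₁ * c := by
  refine (Finset.sum_le_card_nsmul Finset.univ f c fun G _ => h G).trans (le_of_eq ?_)
  rw [Finset.card_univ, nsmul_eq_mul, matCard]

theorem sum_ind_mulVec_eq {u : Fin k₁ → ZMod q} (hu : u ≠ 0) (v : Fin n → ZMod q) :
    ∑ G : Matrix (Fin n) (Fin k₁) (ZMod q), ind (G *ᵥ u = v) = matCard q n k₁ / (q : ℝ) ^ n := by
  rw [sum_mulVec_one hu (fun s => ind (s = v)), matCard]
  classical
  rw [sum_ind, Finset.filter_eq' Finset.univ v]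
  simp

/-- The zero message contributes 1 to the mean; every other message lies in the kernel with
probability `q ^ (-n)`, and there are at most `q ^ n` of them. -/
theorem sum_kerCard_le (hk : k₁ ≤ n) :
    ∑ G : Matrix (Fin n) (Fin k₁) (ZMod q), (kerCard G : ℝ) ≤ matCard q n k₁ * 2 := by
  have hq : (1 : ℝ) ≤ q := by exact_mod_cast (Fact.out : q.Prime).one_le
  have hM := (matCard_pos q n k₁).le
  have h1 : ∀ G : Matrix (Fin n) (Fin k₁) (ZMod q), (kerCard G : ℝ)
      = ∑ v, ind (G *ᵥ v = 0) := fun G => (sum_ind _).symm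
  simp only [h1]
  rw [Finset.sum_comm]
  have h2 : ∀ v : Fin k₁ → ZMod q, ∑ G : Matrix (Fin n) (Fin k₁) (ZMod q), ind (G *ᵥ v = 0)
      ≤ matCard q n k₁ / (q : ℝ) ^ n + (if v = 0 then matCard q n k₁ else 0) := by
    intro v
    split_ifs with h
    · have := sum_le_matCard (f := fun G : Matrix (Fin n) (Fin k₁) (ZMod q) => ind (G *ᵥ v = 0))
        fun _ => ind_le_one _
      have h0 : 0 ≤ matCard q n k₁ / (q : ℝ) ^ n := by positivity
      linarith
    · rw [sum_ind_mulVec_eq h, add_zero]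
  refine (Finset.sum_le_sum fun v _ => h2 v).trans ?_
  rw [Finset.sum_add_distrib, Finset.sum_const, Finset.card_univ, nsmul_eq_mul, card_vec,
    Finset.sum_ite_eq' Finset.univ]
  simp only [Finset.mem_univ, if_true]
  have h3 : (q : ℝ) ^ k₁ * (matCard q n k₁ / (q : ℝ) ^ n) ≤ matCard q n k₁ := by
    rw [mul_div_assoc', div_le_iff₀ (by positivity), mul_comm]
    have := pow_le_pow_right₀ hq hk
    gcongr
  linarith

theorem sum_ind_kerCard_le (hk : k₁ ≤ n) {κ : ℝ} (hκ : 0 < κ) :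
    ∑ G : Matrix (Fin n) (Fin k₁) (ZMod q), ind (κ < kerCard G) ≤ matCard q n k₁ * (2 / κ) := by
  refine (Finset.sum_le_sum fun G _ => ind_lt_le_div hκ (Nat.cast_nonneg _)).trans ?_
  rw [← Finset.sum_div, mul_div_assoc']
  have := sum_kerCard_le (q := q) hk
  gcongr

/-- The messages are in general position: both codewords are uniform and independent. -/
def IsIndepMsg (p : (Fin k₁ → ZMod q) × (Fin k₂ → ZMod q)) : Prop :=
  LinearIndependent (ZMod q) ![pad k₁ p.2, p.1]

theorem IsIndepMsg.add_ne_zero {p : (Fin k₁ → ZMod q) × (Fin k₂ → ZMod q)}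
    (h : IsIndepMsg p) : p.1 + pad k₁ p.2 ≠ 0 := by
  have h0 : pad k₁ p.2 ≠ 0 := h.ne_zero 0
  intro hs
  refine (LinearIndependent.pair_iff' h0).1 h (-1) ?_
  rw [neg_smul, one_smul]
  exact (eq_neg_of_add_eq_zero_left hs).symm

/-- A dependent pair has second message zero or first message a multiple of the padded second one.
As a fraction of all pairs this is negligible only when `k₂` is large. -/
theorem sum_ind_not_isIndepMsg_le (hk : k₂ ≤ k₁) :
    ∑ p : (Fin k₁ → ZMod q) × (Fin k₂ → ZMod q), ind (¬ IsIndepMsg p)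
      ≤ (q : ℝ) ^ k₁ + q * (q : ℝ) ^ k₂ := by
  classical
  rw [sum_ind]
  have hsub : (Finset.univ.filter fun p : (Fin k₁ → ZMod q) × (Fin k₂ → ZMod q) =>
      ¬ IsIndepMsg p) ⊆ (Finset.univ.image fun m : Fin k₁ → ZMod q => (m, 0))
        ∪ Finset.univ.image fun r : ZMod q × (Fin k₂ → ZMod q) => (r.1 • pad k₁ r.2, r.2) := by
    intro p hp
    have hp' : ¬ IsIndepMsg p := (Finset.mem_filter.1 hp).2
    by_cases h0 : pad k₁ p.2 = 0
    · refine Finset.mem_union_left _ (Finset.mem_image.2 ⟨p.1, Finset.mem_univ _, ?_⟩)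
      exact Prod.ext rfl (pad_injective hk (by rw [pad_zero, h0]))
    · rw [IsIndepMsg, LinearIndependent.pair_iff' h0] at hp'
      push Not at hp'
      obtain ⟨a, ha⟩ := hp'
      exact Finset.mem_union_right _
        (Finset.mem_image.2 ⟨(a, p.2), Finset.mem_univ _, Prod.ext ha rfl⟩)
  have h1 := (Finset.card_le_card hsub).trans ((Finset.card_union_le _ _).trans
    (add_le_add Finset.card_image_le Finset.card_image_le))
  rw [Finset.card_univ, Finset.card_univ, Fintype.card_prod, ZMod.card] at h1
  rw [← card_vec, ← card_vec]
  exact_mod_cast h1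

theorem sum_swap_translate (d : Fin n → ZMod q)
    (S : (Fin n → ZMod q) × (Fin n → ZMod q) → ℝ) :
    ∑ s : (Fin n → ZMod q) × (Fin n → ZMod q), S (s.2 + d, s.1) = ∑ s, S s := by
  rw [← ((Equiv.prodComm _ _).trans ((Equiv.addRight d).prodCongr (Equiv.refl _))).sum_comp S]
  rfl

theorem exists_sum_ind_not_isTypicalPair_le (q : ℕ) [Fact q.Prime] : ∃ C : ℝ,
    ∀ (n k₁ k₂ : ℕ) (d : Fin n → ZMod q) (δ : ℝ) (p : (Fin k₁ → ZMod q) × (Fin k₂ → ZMod q)),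
      0 < n → 0 < δ → IsIndepMsg p →
      ∑ G : Matrix (Fin n) (Fin k₁) (ZMod q),
        ind (¬ IsTypicalPair δ (G *ᵥ p.1 + d, G *ᵥ pad k₁ p.2))
        ≤ matCard q n k₁ * (C / (n * δ ^ 2)) := by
  obtain ⟨C, hC⟩ := card_not_isTypicalPair_le q
  have hq : (0 : ℝ) < q := by exact_mod_cast (Fact.out : q.Prime).pos
  classical
  refine ⟨C, fun n k₁ k₂ d δ p hn hδ hp => ?_⟩
  have hM := (matCard_pos q n k₁).le
  rw [sum_mulVec_two hp (fun s => ind (¬ IsTypicalPair δ (s.2 + d, s.1))),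
    sum_swap_translate d (fun s => ind (¬ IsTypicalPair δ s)), sum_ind,
    ← matCard, div_le_iff₀ (by positivity)]
  calc _ ≤ matCard q n k₁ * ((q : ℝ) ^ n * (q : ℝ) ^ n * (C / (n * δ ^ 2))) := by
        gcongr
        exact hC n hn δ hδ
    _ = _ := by ring

theorem sum_ind_pad_mem_span_le (hk : k₂ ≤ k₁) (u v : Fin k₁ → ZMod q) :
    ∑ y : Fin k₂ → ZMod q, ind (pad k₁ y ∈ Submodule.span (ZMod q) {u, v}) ≤ (q : ℝ) ^ 2 := by
  classical
  rw [sum_ind]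
  have h : ((Finset.univ.filter fun y : Fin k₂ → ZMod q =>
      pad k₁ y ∈ Submodule.span (ZMod q) {u, v}).card)
      ≤ (Finset.univ.image fun r : ZMod q × ZMod q => r.1 • u + r.2 • v).card := by
    refine Finset.card_le_card_of_injOn (pad k₁) ?_ (pad_injective hk).injOn
    intro y hy
    have hy' : pad k₁ y ∈ Submodule.span (ZMod q) {u, v} := by simpa using hy
    obtain ⟨a, b, hab⟩ := Submodule.mem_span_pair.1 hy'
    simp only [Finset.coe_image, Finset.coe_univ, Set.image_univ, Set.mem_range]
    exact ⟨(a, b), hab⟩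
  have h2 := h.trans Finset.card_image_le
  rw [Finset.card_univ, Fintype.card_prod, ZMod.card, ← sq] at h2
  exact_mod_cast h2

/-- Distinct shifts preserving an integer sum give distinct representations of it, so a typical pair
admits at most `vecMult` of them. -/
theorem sum_shift_le (d : Fin n → ZMod q) (δ : ℝ) :
    ∑ s : (Fin n → ZMod q) × (Fin n → ZMod q) × (Fin n → ZMod q),
      ind (IsTypicalPair δ (s.2.2 + d, s.2.1)
        ∧ intSum (s.2.2 + d - s.1) (s.2.1 + s.1) = intSum (s.2.2 + d) s.2.1)
      ≤ (q : ℝ) ^ n * (q : ℝ) ^ n * 2 ^ (n * (Real.logb 2 q - D q + δ)) := by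
  classical
  rw [Fintype.sum_prod_type_right]
  have h : ∀ s : (Fin n → ZMod q) × (Fin n → ZMod q), ∑ v : Fin n → ZMod q,
      ind (IsTypicalPair δ (s.2 + d, s.1)
        ∧ intSum (s.2 + d - v) (s.1 + v) = intSum (s.2 + d) s.1)
      ≤ 2 ^ (n * (Real.logb 2 q - D q + δ)) := by
    intro s
    by_cases ht : IsTypicalPair δ (s.2 + d, s.1)
    · refine le_trans ?_ ht.vecMult_le
      rw [sum_ind, vecMult]
      refine Nat.cast_le.2 (Finset.card_le_card_of_injOn (fun v => (s.2 + d - v, s.1 + v)) ?_ ?_)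
      · intro v hv
        simpa [ht] using hv
      · intro v _ w _ hvw
        exact add_left_cancel (Prod.ext_iff.1 hvw).2
    · simp only [ht, false_and, ind, if_false, Finset.sum_const_zero]
      positivity
  refine (Finset.sum_le_sum fun s _ => h s).trans ?_
  rw [Finset.sum_const, Finset.card_univ, Fintype.card_prod, nsmul_eq_mul, Nat.cast_mul, card_vec]

/-- If `pad k₁ y` is outside the span of the two messages, the three codewords are jointly uniform
and `sum_shift_le` applies. The at most `q ^ 2` shifts inside the span are bounded trivially. -/
theorem sum_typical_shiftMult_le (hk : k₂ ≤ k₁) (d : Fin n → ZMod q) (δ : ℝ)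
    {p : (Fin k₁ → ZMod q) × (Fin k₂ → ZMod q)} (hp : IsIndepMsg p) :
    ∑ G : Matrix (Fin n) (Fin k₁) (ZMod q),
      ind (IsTypicalPair δ (G *ᵥ p.1 + d, G *ᵥ pad k₁ p.2)) * shiftMult G d p
      ≤ matCard q n k₁ * ((q : ℝ) ^ 2
        + (q : ℝ) ^ k₂ * (2 ^ (n * (Real.logb 2 q - D q + δ)) / (q : ℝ) ^ n)) := by
  classical
  have hq : (0 : ℝ) < q := by exact_mod_cast (Fact.out : q.Prime).pos
  have hM := (matCard_pos q n k₁).le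
  let F : (Fin n → ZMod q) × (Fin n → ZMod q) × (Fin n → ZMod q) → ℝ := fun s =>
    ind (IsTypicalPair δ (s.2.2 + d, s.2.1)
        ∧ intSum (s.2.2 + d - s.1) (s.2.1 + s.1) = intSum (s.2.2 + d) s.2.1)
  have h1 : ∀ G : Matrix (Fin n) (Fin k₁) (ZMod q),
      ind (IsTypicalPair δ (G *ᵥ p.1 + d, G *ᵥ pad k₁ p.2)) * shiftMult G d p
        = ∑ y : Fin k₂ → ZMod q, F (G *ᵥ pad k₁ y, G *ᵥ pad k₁ p.2, G *ᵥ p.1) := by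
    intro G
    rw [shiftMult, ← sum_ind, Finset.mul_sum]
    refine Finset.sum_congr rfl fun y _ => ?_
    simp only [F, ind_and, msgSum]
  simp only [h1]
  rw [Finset.sum_comm]
  have h2 : ∀ y : Fin k₂ → ZMod q, ∑ G : Matrix (Fin n) (Fin k₁) (ZMod q),
      F (G *ᵥ pad k₁ y, G *ᵥ pad k₁ p.2, G *ᵥ p.1)
      ≤ matCard q n k₁ * ind (pad k₁ y ∈ Submodule.span (ZMod q) {pad k₁ p.2, p.1})
        + matCard q n k₁ * (2 ^ (n * (Real.logb 2 q - D q + δ)) / (q : ℝ) ^ n) := by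
    intro y
    by_cases hy : pad k₁ y ∈ Submodule.span (ZMod q) {pad k₁ p.2, p.1}
    · rw [ind_of_true hy, mul_one]
      have h1 := sum_le_matCard (f := fun G : Matrix (Fin n) (Fin k₁) (ZMod q) =>
        F (G *ᵥ pad k₁ y, G *ᵥ pad k₁ p.2, G *ᵥ p.1)) fun _ => ind_le_one _
      refine h1.trans ?_
      rw [mul_one]
      exact le_add_of_nonneg_right (by positivity)
    · have hli : LinearIndependent (ZMod q) ![pad k₁ y, pad k₁ p.2, p.1] := by
        refine linearIndependent_finCons.2 ⟨hp, ?_⟩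
        simpa [Matrix.range_cons, Set.pair_comm] using hy
      rw [sum_mulVec_three hli F, ← matCard, div_le_iff₀ (by positivity)]
      calc matCard q n k₁ * ∑ s, F s
          ≤ matCard q n k₁ * ((q : ℝ) ^ n * (q : ℝ) ^ n
            * 2 ^ (n * (Real.logb 2 q - D q + δ))) := by
            gcongr
            exact sum_shift_le d δ
        _ = matCard q n k₁ * (2 ^ (n * (Real.logb 2 q - D q + δ)) / (q : ℝ) ^ n)
            * ((q : ℝ) ^ n * ((q : ℝ) ^ n * (q : ℝ) ^ n)) := by
            field_simp
        _ ≤ _ := by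
            gcongr
            exact le_add_of_nonneg_left (mul_nonneg (by positivity) (ind_nonneg _))
  refine (Finset.sum_le_sum fun y _ => h2 y).trans ?_
  rw [Finset.sum_add_distrib, ← Finset.mul_sum, Finset.sum_const, Finset.card_univ, nsmul_eq_mul,
    card_vec]
  have h3 := mul_le_mul_of_nonneg_left (sum_ind_pad_mem_span_le hk (pad k₁ p.2) p.1) hM
  linarith

/-- Averaged over the matrix, few messages in general position have a typical sum with few
representations: there are few typical sums congruent to a codeword of the coset. -/
theorem sum_ind_msgMult_lt_le (d : Fin n → ZMod q) (δ : ℝ) {θ : ℝ} (hθ : 0 ≤ θ) :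
    ∑ G : Matrix (Fin n) (Fin k₁) (ZMod q), ∑ p : (Fin k₁ → ZMod q) × (Fin k₂ → ZMod q),
      ind (IsIndepMsg p ∧ IsTypicalPair δ (G *ᵥ p.1 + d, G *ᵥ pad k₁ p.2)
        ∧ (msgMult G d p : ℝ) < θ)
      ≤ matCard q n k₁ * ((q : ℝ) ^ k₁ * (2 ^ (n * (Real.logb 2 q + D q + δ)) / (q : ℝ) ^ n)
        * θ) := by
  classical
  have hq : (0 : ℝ) < q := by exact_mod_cast (Fact.out : q.Prime).pos
  have hM := (matCard_pos q n k₁).le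
  let red : (Fin n → ℤ) → Fin n → ZMod q := fun w i => ((w i : ℤ) : ZMod q)
  have h1 : ∀ G : Matrix (Fin n) (Fin k₁) (ZMod q),
      ∑ p : (Fin k₁ → ZMod q) × (Fin k₂ → ZMod q),
        ind (IsIndepMsg p ∧ IsTypicalPair δ (G *ᵥ p.1 + d, G *ᵥ pad k₁ p.2)
          ∧ (msgMult G d p : ℝ) < θ)
        ≤ (∑ m : Fin k₁ → ZMod q, ∑ w ∈ typicalSums q n δ,
          ind (m ≠ 0 ∧ G *ᵥ m = red w - d)) * θ := by
    intro G
    rw [sum_ind]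
    set S := Finset.univ.filter fun p : (Fin k₁ → ZMod q) × (Fin k₂ → ZMod q) =>
      IsIndepMsg p ∧ IsTypicalPair δ (G *ᵥ p.1 + d, G *ᵥ pad k₁ p.2)
          ∧ (msgMult G d p : ℝ) < θ with hS
    -- Group the messages by their sum: each group has fewer than `θ` members.
    have hcard : (S.card : ℝ) ≤ (S.image (msgSum G d)).card * θ := by
      have h := Finset.card_eq_sum_card_image (msgSum G d) S
      rw [h, Nat.cast_sum, ← nsmul_eq_mul]
      refine Finset.sum_le_card_nsmul _ _ _ fun w hw => ?_
      obtain ⟨p, hp, rfl⟩ := Finset.mem_image.1 hw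
      refine le_trans ?_ (Finset.mem_filter.1 hp).2.2.2.le
      exact Nat.cast_le.2 (Finset.card_le_card
        (Finset.filter_subset_filter _ (Finset.subset_univ _)))
    refine hcard.trans ?_
    gcongr
    -- Modulo `q` the sum is the coset word of `p.1 + pad k₁ p.2`. This message is nonzero by
    -- independence, so its codeword is uniform.
    have hsub : S.image (msgSum G d) ⊆ (typicalSums q n δ).filter fun w =>
        ∃ m : Fin k₁ → ZMod q, m ≠ 0 ∧ G *ᵥ m = red w - d := by
      intro w hw
      obtain ⟨p, hp, rfl⟩ := Finset.mem_image.1 hw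
      obtain ⟨-, hi, ht, -⟩ := Finset.mem_filter.1 hp
      refine Finset.mem_filter.2 ⟨Finset.mem_image.2 ⟨_, Finset.mem_filter.2
        ⟨Finset.mem_univ _, ht⟩, rfl⟩, p.1 + pad k₁ p.2, hi.add_ne_zero, ?_⟩
      have : red (msgSum G d p) = G *ᵥ p.1 + d + G *ᵥ pad k₁ p.2 := intSum_cast _ _
      rw [this, Matrix.mulVec_add]
      abel
    refine (Nat.cast_le.2 (Finset.card_le_card hsub)).trans ?_
    rw [Finset.sum_comm, Finset.card_filter, Nat.cast_sum]
    refine Finset.sum_le_sum fun w _ => ?_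
    split_ifs with h
    · obtain ⟨m, hm⟩ := h
      rw [Nat.cast_one, ← ind_of_true hm]
      exact Finset.single_le_sum (f := fun m : Fin k₁ → ZMod q => ind (m ≠ 0 ∧ G *ᵥ m = red w - d))
        (fun _ _ => ind_nonneg _) (Finset.mem_univ m)
    · rw [Nat.cast_zero]
      exact Finset.sum_nonneg fun _ _ => ind_nonneg _
  refine (Finset.sum_le_sum fun G _ => h1 G).trans ?_
  rw [← Finset.sum_mul, ← mul_assoc]
  gcongr
  rw [Finset.sum_comm]
  have h2 : ∀ m : Fin k₁ → ZMod q, ∑ G : Matrix (Fin n) (Fin k₁) (ZMod q),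
      ∑ w ∈ typicalSums q n δ, ind (m ≠ 0 ∧ G *ᵥ m = red w - d)
      ≤ matCard q n k₁ * (2 ^ (n * (Real.logb 2 q + D q + δ)) / (q : ℝ) ^ n) := by
    intro m
    by_cases hm : m = 0
    · simp only [hm, ne_eq, not_true_eq_false, false_and, ind, if_false, Finset.sum_const_zero]
      positivity
    · rw [Finset.sum_comm]
      have h3 : ∀ w ∈ typicalSums q n δ, ∑ G : Matrix (Fin n) (Fin k₁) (ZMod q),
          ind (m ≠ 0 ∧ G *ᵥ m = red w - d) = matCard q n k₁ / (q : ℝ) ^ n := by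
        intro w _
        rw [← sum_ind_mulVec_eq hm (red w - d)]
        simp [hm]
      rw [Finset.sum_congr rfl h3, Finset.sum_const, nsmul_eq_mul]
      calc _ = matCard q n k₁ * ((typicalSums q n δ).card / (q : ℝ) ^ n) := by ring
        _ ≤ _ := by
          gcongr
          exact card_typicalSums_le q n δ
  refine (Finset.sum_le_sum fun m _ => h2 m).trans (le_of_eq ?_)
  rw [Finset.sum_const, Finset.card_univ, nsmul_eq_mul, card_vec]
  ring

end Averages

section Averages

variable {q : ℕ} [Fact q.Prime] {n k₁ k₂ : ℕ}

theorem sum_ind_kerCard_mul_lt_le (hk : k₁ ≤ n) (d : Fin n → ZMod q) {κ : ℝ} (hκ : 0 < κ) :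
    ∑ G : Matrix (Fin n) (Fin k₁) (ZMod q), ∑ p : (Fin k₁ → ZMod q) × (Fin k₂ → ZMod q),
      ind (κ * shiftMult G d p < msgMult G d p)
      ≤ matCard q n k₁ * ((q : ℝ) ^ k₁ * (q : ℝ) ^ k₂) * (2 / κ) := by
  have h : ∀ G : Matrix (Fin n) (Fin k₁) (ZMod q),
      ∑ p : (Fin k₁ → ZMod q) × (Fin k₂ → ZMod q), ind (κ * shiftMult G d p < msgMult G d p)
      ≤ (q : ℝ) ^ k₁ * (q : ℝ) ^ k₂ * ind (κ < kerCard G) := by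
    intro G
    have h1 : ∀ p ∈ (Finset.univ : Finset ((Fin k₁ → ZMod q) × (Fin k₂ → ZMod q))),
        ind (κ * shiftMult G d p < msgMult G d p) ≤ ind (κ < kerCard G) := by
      intro p _
      refine ind_mono fun hp => ?_
      by_contra! hle
      have h2 : (msgMult G d p : ℝ) ≤ kerCard G * shiftMult G d p := by
        exact_mod_cast msgMult_le G d p
      have h3 : (kerCard G : ℝ) * shiftMult G d p ≤ κ * shiftMult G d p := by gcongr
      linarith
    refine (Finset.sum_le_card_nsmul _ _ _ h1).trans (le_of_eq ?_)
    rw [Finset.card_univ, Fintype.card_prod, nsmul_eq_mul, Nat.cast_mul, card_vec, card_vec]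
  refine (Finset.sum_le_sum fun G _ => h G).trans ?_
  rw [← Finset.mul_sum]
  have hA : (0 : ℝ) ≤ (q : ℝ) ^ k₁ * (q : ℝ) ^ k₂ := by positivity
  have := mul_le_mul_of_nonneg_left (sum_ind_kerCard_le (q := q) hk hκ) hA
  linarith

/-- Sums over matrices and messages are controlled message by message. -/
theorem sum_sum_le {f : Matrix (Fin n) (Fin k₁) (ZMod q) →
    (Fin k₁ → ZMod q) × (Fin k₂ → ZMod q) → ℝ} {c : ℝ}
    (h : ∀ p, ∑ G, f G p ≤ matCard q n k₁ * c) :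
    ∑ G, ∑ p, f G p ≤ matCard q n k₁ * ((q : ℝ) ^ k₁ * (q : ℝ) ^ k₂) * c := by
  rw [Finset.sum_comm]
  refine (Finset.sum_le_card_nsmul _ _ _ fun p _ => h p).trans (le_of_eq ?_)
  rw [Finset.card_univ, Fintype.card_prod, nsmul_eq_mul, Nat.cast_mul, card_vec, card_vec]
  ring

/-- A union bound over the five ways to fail, one per term: a large kernel, dependent messages, an
atypical pair, too many shifts, too few representations. The parameters `κ`, `τ`, `θ` remain free.
-/
theorem exists_sum_ind_not_msgMult_mem_le (q : ℕ) [Fact q.Prime] : ∃ C : ℝ,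
    ∀ (n k₁ k₂ : ℕ) (d : Fin n → ZMod q) (δ κ τ θ : ℝ), 0 < n → k₂ ≤ k₁ → k₁ ≤ n →
      0 < δ → 0 < κ → 0 < τ → 0 ≤ θ →
      ∑ G : Matrix (Fin n) (Fin k₁) (ZMod q), ∑ p : (Fin k₁ → ZMod q) × (Fin k₂ → ZMod q),
        ind (¬ (θ ≤ msgMult G d p ∧ msgMult G d p ≤ κ * τ))
        ≤ matCard q n k₁ * ((q : ℝ) ^ k₁ * (q : ℝ) ^ k₂) *
          (2 / κ + (1 / (q : ℝ) ^ k₂ + q / (q : ℝ) ^ k₁) + |C| / (n * δ ^ 2)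
            + ((q : ℝ) ^ 2 + (q : ℝ) ^ k₂ * (2 ^ (n * (Real.logb 2 q - D q + δ)) / (q : ℝ) ^ n)) / τ
            + 2 ^ (n * (Real.logb 2 q + D q + δ)) / (q : ℝ) ^ n / (q : ℝ) ^ k₂ * θ) := by
  obtain ⟨C, hC⟩ := exists_sum_ind_not_isTypicalPair_le q
  have hq : (0 : ℝ) < q := by exact_mod_cast (Fact.out : q.Prime).pos
  refine ⟨C, fun n k₁ k₂ d δ κ τ θ hn hk₂ hk₁ hδ hκ hτ hθ => ?_⟩
  have hM := (matCard_pos q n k₁).le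
  set T : Matrix (Fin n) (Fin k₁) (ZMod q) → (Fin k₁ → ZMod q) × (Fin k₂ → ZMod q) → Prop :=
    fun G p => IsTypicalPair δ (G *ᵥ p.1 + d, G *ᵥ pad k₁ p.2) with hT
  have hpt : ∀ G p, ind (¬ (θ ≤ msgMult G d p ∧ msgMult G d p ≤ κ * τ))
      ≤ ind (κ * shiftMult G d p < msgMult G d p) + ind (¬ IsIndepMsg p)
        + ind (IsIndepMsg p ∧ ¬ T G p) + ind (IsIndepMsg p) * (ind (T G p) * ind (τ < shiftMult G d p))
        + ind (IsIndepMsg p ∧ T G p ∧ (msgMult G d p : ℝ) < θ) := by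
    intro G p
    have n1 := ind_nonneg (κ * shiftMult G d p < msgMult G d p)
    have n2 := ind_nonneg (¬ IsIndepMsg p)
    have n3 := ind_nonneg (IsIndepMsg p ∧ ¬ T G p)
    have n4 : 0 ≤ ind (IsIndepMsg p) * (ind (T G p) * ind (τ < shiftMult G d p)) :=
      mul_nonneg (ind_nonneg _) (mul_nonneg (ind_nonneg _) (ind_nonneg _))
    have n5 := ind_nonneg (IsIndepMsg p ∧ T G p ∧ (msgMult G d p : ℝ) < θ)
    have n0 := ind_le_one (¬ (θ ≤ msgMult G d p ∧ msgMult G d p ≤ κ * τ))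
    by_cases h1 : κ * shiftMult G d p < msgMult G d p
    · rw [ind_of_true h1]; linarith
    by_cases h2 : ¬ IsIndepMsg p
    · rw [ind_of_true h2]; linarith
    rw [not_not] at h2
    by_cases h3 : ¬ T G p
    · rw [ind_of_true (show IsIndepMsg p ∧ ¬ T G p from ⟨h2, h3⟩)]; linarith
    rw [not_not] at h3
    by_cases h4 : τ < shiftMult G d p
    · rw [ind_of_true h4, ind_of_true h2, ind_of_true h3]; linarith
    by_cases h5 : (msgMult G d p : ℝ) < θ
    · rw [ind_of_true (show IsIndepMsg p ∧ T G p ∧ (msgMult G d p : ℝ) < θ from ⟨h2, h3, h5⟩)]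
      linarith
    have h6 : ¬¬ (θ ≤ msgMult G d p ∧ msgMult G d p ≤ κ * τ) := by
      rw [not_not]
      refine ⟨not_lt.1 h5, (not_lt.1 h1).trans ?_⟩
      have := not_lt.1 h4
      gcongr
    simp only [ind, h6, if_false] at *
    linarith
  refine (Finset.sum_le_sum fun G _ => Finset.sum_le_sum fun p _ => hpt G p).trans ?_
  simp only [Finset.sum_add_distrib]
  have b1 := sum_ind_kerCard_mul_lt_le (k₂ := k₂) hk₁ d hκ
  have b2 : ∑ G : Matrix (Fin n) (Fin k₁) (ZMod q),
      ∑ p : (Fin k₁ → ZMod q) × (Fin k₂ → ZMod q), ind (¬ IsIndepMsg p)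
      ≤ matCard q n k₁ * ((q : ℝ) ^ k₁ * (q : ℝ) ^ k₂) * (1 / (q : ℝ) ^ k₂ + q / (q : ℝ) ^ k₁) := by
    refine (sum_le_matCard fun _ => sum_ind_not_isIndepMsg_le hk₂).trans (le_of_eq ?_)
    field_simp
  have b3 : ∑ G : Matrix (Fin n) (Fin k₁) (ZMod q),
      ∑ p : (Fin k₁ → ZMod q) × (Fin k₂ → ZMod q), ind (IsIndepMsg p ∧ ¬ T G p)
      ≤ matCard q n k₁ * ((q : ℝ) ^ k₁ * (q : ℝ) ^ k₂) * (|C| / (n * δ ^ 2)) := by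
    refine sum_sum_le fun p => ?_
    simp only [ind_and, ← Finset.mul_sum]
    by_cases hp : IsIndepMsg p
    · rw [ind_of_true hp, one_mul]
      refine (hC n k₁ k₂ d δ p hn hδ hp).trans ?_
      gcongr
      exact le_abs_self C
    · simp only [ind, hp, if_false, zero_mul]
      positivity
  have b4 : ∑ G : Matrix (Fin n) (Fin k₁) (ZMod q),
      ∑ p : (Fin k₁ → ZMod q) × (Fin k₂ → ZMod q),
        ind (IsIndepMsg p) * (ind (T G p) * ind (τ < shiftMult G d p))
      ≤ matCard q n k₁ * ((q : ℝ) ^ k₁ * (q : ℝ) ^ k₂) * (((q : ℝ) ^ 2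
        + (q : ℝ) ^ k₂ * (2 ^ (n * (Real.logb 2 q - D q + δ)) / (q : ℝ) ^ n)) / τ) := by
    refine sum_sum_le fun p => ?_
    rw [← Finset.mul_sum]
    by_cases hp : IsIndepMsg p
    · rw [ind_of_true hp, one_mul, ← mul_div_assoc]
      refine le_trans ?_ (div_le_div_of_nonneg_right (sum_typical_shiftMult_le hk₂ d δ hp) hτ.le)
      rw [Finset.sum_div]
      refine Finset.sum_le_sum fun G _ => ?_
      rw [mul_div_assoc]
      exact mul_le_mul_of_nonneg_left (ind_lt_le_div hτ (Nat.cast_nonneg _)) (ind_nonneg _)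
    · simp only [ind, hp, if_false, zero_mul]
      positivity
  have b5 := sum_ind_msgMult_lt_le (k₁ := k₁) (k₂ := k₂) d δ hθ
  have b5' : matCard q n k₁ * ((q : ℝ) ^ k₁
      * (2 ^ (n * (Real.logb 2 q + D q + δ)) / (q : ℝ) ^ n) * θ)
      = matCard q n k₁ * ((q : ℝ) ^ k₁ * (q : ℝ) ^ k₂)
        * (2 ^ (n * (Real.logb 2 q + D q + δ)) / (q : ℝ) ^ n / (q : ℝ) ^ k₂ * θ) := by
    field_simp
  rw [b5'] at b5
  simp only [mul_add (matCard q n k₁ * ((q : ℝ) ^ k₁ * (q : ℝ) ^ k₂))] at *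
  linarith

end Averages

/-! ### From multiplicities to a typical sumset -/

section Typical

variable {q : ℕ} [Fact q.Prime] {n k₁ k₂ : ℕ}

theorem DotEqAt.mono {ε ε' : ℝ} {n : ℕ} {a X : ℝ} (hX : 0 ≤ X) (hε : ε ≤ ε')
    (h : DotEqAt ε n a X) : DotEqAt ε' n a X := by
  refine ⟨le_trans ?_ h.1, h.2.trans ?_⟩
  · gcongr
    exact one_le_two
  · gcongr
    exact one_le_two

theorem IsNormalTypical.mono {q : ℕ} {R₁ R₂ ε ε' η η' : ℝ} {n : ℕ} {A B K : Set (Fin n → ℤ)}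
    (h : IsNormalTypical q R₁ R₂ ε η A B K) (hε : ε ≤ ε') (hη : η ≤ η') :
    IsNormalTypical q R₁ R₂ ε' η' A B K where
  subset := h.subset
  typical := le_trans (by linarith) h.typical
  size := h.size.mono (by positivity) hε
  aep := fun w hw => (h.aep w hw).mono (by positivity) hε

/-- If most pairs of messages have a sum of about the right probability, the sums of about the
right probability form a normal typical sumset. -/
theorem exists_isNormalTypical {R₁ R₂ ε η : ℝ} (hε : 0 ≤ ε)
    (G : Matrix (Fin n) (Fin k₁) (ZMod q)) (d : Fin n → ZMod q)
    (hη : (2 : ℝ) ^ (-((n : ℝ) * ε)) ≤ 1 - η)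
    (hbad : ∑ p : (Fin k₁ → ZMod q) × (Fin k₂ → ZMod q),
      ind (¬ DotEqAt ε n (msgMult G d p / ((q : ℝ) ^ k₁ * (q : ℝ) ^ k₂))
        (max ((2 : ℝ) ^ (-((n : ℝ) * (R₁ + R₂)))) ((2 : ℝ) ^ (-((n : ℝ) * (max R₁ R₂ + D q))))))
      ≤ η * ((q : ℝ) ^ k₁ * (q : ℝ) ^ k₂)) :
    ∃ K : Set (Fin n → ℤ), IsNormalTypical q R₁ R₂ (2 * ε) η
      (toInt (coset (code₁ G) d)) (toInt (code₂ k₂ G)) K := by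
  classical
  have hq : (0 : ℝ) < q := by exact_mod_cast (Fact.out : q.Prime).pos
  set X := max ((2 : ℝ) ^ (-((n : ℝ) * (R₁ + R₂)))) ((2 : ℝ) ^ (-((n : ℝ) * (max R₁ R₂ + D q))))
    with hX
  have hXpos : 0 < X := lt_max_of_lt_left (by positivity)
  have hmin : min ((2 : ℝ) ^ ((n : ℝ) * (R₁ + R₂))) ((2 : ℝ) ^ ((n : ℝ) * (max R₁ R₂ + D q)))
      = X⁻¹ := by
    rw [hX]
    rcases le_total ((n : ℝ) * (R₁ + R₂)) ((n : ℝ) * (max R₁ R₂ + D q)) with h | h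
    · rw [min_eq_left (Real.rpow_le_rpow_of_exponent_le one_le_two h),
        max_eq_left (Real.rpow_le_rpow_of_exponent_le one_le_two (neg_le_neg h)),
        Real.rpow_neg two_pos.le, inv_inv]
    · rw [min_eq_right (Real.rpow_le_rpow_of_exponent_le one_le_two h),
        max_eq_right (Real.rpow_le_rpow_of_exponent_le one_le_two (neg_le_neg h)),
        Real.rpow_neg two_pos.le, inv_inv]
  set μ := sumLaw (toInt (coset (code₁ G) d)) (toInt (code₂ k₂ G)) with hμ
  set N : ℝ := (q : ℝ) ^ k₁ * (q : ℝ) ^ k₂ with hN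
  have hNpos : 0 < N := by positivity
  have hreal : ∀ E : Set (Fin n → ℤ), μ.real E
      = ((Finset.univ.filter fun p : (Fin k₁ → ZMod q) × (Fin k₂ → ZMod q) =>
          msgSum G d p ∈ E).card : ℝ) / N := fun E => by
    rw [hμ, sumLaw_code]
  have hsing : ∀ p : (Fin k₁ → ZMod q) × (Fin k₂ → ZMod q),
      μ.real {msgSum G d p} = msgMult G d p / N := fun p => by
    rw [hreal, msgMult]
    simp only [Set.mem_singleton_iff]
  set S := (Finset.univ.filter fun p : (Fin k₁ → ZMod q) × (Fin k₂ → ZMod q) =>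
    DotEqAt ε n (msgMult G d p / N) X) with hS
  set K := S.image (msgSum G d) with hK
  -- Membership in `S` depends only on the sum, so `S` is a union of fibres and `K` has probability
  -- exactly `S.card / N`.
  have hmemK : ∀ p, msgSum G d p ∈ K ↔ p ∈ S := by
    refine fun p => ⟨fun h => ?_, fun h => Finset.mem_image_of_mem _ h⟩
    obtain ⟨r, hr, hrp⟩ := Finset.mem_image.1 h
    have := (Finset.mem_filter.1 hr).2
    rw [← hsing, hrp, hsing] at this
    exact Finset.mem_filter.2 ⟨Finset.mem_univ _, this⟩
  have haep : ∀ w ∈ K, DotEqAt ε n (μ.real {w}) X := by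
    intro w hw
    obtain ⟨p, hp, rfl⟩ := Finset.mem_image.1 hw
    rw [hsing]
    exact (Finset.mem_filter.1 hp).2
  have hKreal : μ.real (K : Set (Fin n → ℤ)) = S.card / N := by
    rw [hreal]
    congr 3
    ext p
    simp only [Finset.mem_coe, hmemK, Finset.mem_filter, Finset.mem_univ, true_and]
  have htot : (S.card : ℝ) + ∑ p : (Fin k₁ → ZMod q) × (Fin k₂ → ZMod q),
      ind (¬ DotEqAt ε n (msgMult G d p / N) X) = N := by
    rw [sum_ind, hS, ← Nat.cast_add, Finset.card_filter_add_card_filter_not, Finset.card_univ,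
      Fintype.card_prod, Nat.cast_mul, card_vec, card_vec]
  have htyp : 1 - η ≤ μ.real (K : Set (Fin n → ℤ)) := by
    rw [hKreal, le_div_iff₀ hNpos]
    linarith
  have hle1 : μ.real (K : Set (Fin n → ℤ)) ≤ 1 := by
    rw [hKreal, div_le_one hNpos]
    have : 0 ≤ ∑ p : (Fin k₁ → ZMod q) × (Fin k₂ → ZMod q),
      ind (¬ DotEqAt ε n (msgMult G d p / N) X) := Finset.sum_nonneg fun _ _ => ind_nonneg _
    linarith
  have hsum : μ.real (K : Set (Fin n → ℤ)) = ∑ w ∈ K, μ.real {w} := by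
    rw [hKreal]
    have h := Finset.card_eq_sum_card_image (msgSum G d) S
    rw [h, Nat.cast_sum, Finset.sum_div]
    refine Finset.sum_congr rfl fun w hw => ?_
    rw [hreal]
    congr 3
    ext p
    simp only [Finset.mem_filter, Finset.mem_univ, true_and, Set.mem_singleton_iff,
      and_iff_right_iff_imp]
    rintro rfl
    exact (hmemK p).1 hw
  have hlow : (K.card : ℝ) * (X * (2 : ℝ) ^ (-((n : ℝ) * ε))) ≤ 1 := by
    refine le_trans ?_ hle1
    rw [hsum, ← nsmul_eq_mul]
    exact Finset.card_nsmul_le_sum _ _ _ fun w hw => (haep w hw).1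
  have hup : 1 - η ≤ (K.card : ℝ) * (X * (2 : ℝ) ^ ((n : ℝ) * ε)) := by
    refine htyp.trans ?_
    rw [hsum, ← nsmul_eq_mul]
    exact Finset.sum_le_card_nsmul _ _ _ fun w hw => (haep w hw).2
  refine ⟨K, ⟨?_, htyp, ?_, fun w hw => (haep w hw).mono hXpos.le (by linarith)⟩⟩
  · intro w hw
    obtain ⟨p, -, rfl⟩ := Finset.mem_image.1 hw
    exact Set.mem_add.2 ⟨_, ⟨_, ⟨_, ⟨p.1, rfl⟩, rfl⟩, rfl⟩, _, ⟨_, ⟨p.2, rfl⟩, rfl⟩, rfl⟩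
  -- The size follows by dividing the total mass, between `1 - η` and 1, by the mass of a point. The
  -- loss `1 - η ≥ 2 ^ (-n ε)` is absorbed by doubling `ε`.
  · rw [hmin, Set.ncard_coe_finset]
    set e := (2 : ℝ) ^ ((n : ℝ) * ε) with he
    have hepos : 0 < e := by positivity
    have he1 : 1 ≤ e := Real.one_le_rpow one_le_two (by positivity)
    have hneg : (2 : ℝ) ^ (-((n : ℝ) * ε)) = e⁻¹ := Real.rpow_neg two_pos.le _
    have he2 : (2 : ℝ) ^ ((n : ℝ) * (2 * ε)) = e * e := by
      rw [he, ← Real.rpow_add two_pos]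
      congr 1
      ring
    rw [hneg] at hη hlow
    refine ⟨?_, ?_⟩
    · rw [Real.rpow_neg two_pos.le, he2, ← mul_inv, inv_le_iff_one_le_mul₀ (by positivity)]
      have h3 := hη.trans hup
      rw [inv_le_iff_one_le_mul₀ hepos] at h3
      linarith
    · rw [he2, inv_mul_eq_div, le_div_iff₀ hXpos]
      rw [← mul_assoc, ← div_eq_mul_inv, div_le_one hepos] at hlow
      nlinarith

end Typical

/-! ### Choice of parameters and asymptotics -/

section Asymptotics

theorem natCast_pow_eq_rpow {q : ℕ} [Fact q.Prime] (k : ℕ) :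
    (q : ℝ) ^ k = 2 ^ (k * Real.logb 2 q) := by
  have hq : (0 : ℝ) < q := by exact_mod_cast (Fact.out : q.Prime).pos
  rw [mul_comm, Real.rpow_mul two_pos.le, Real.rpow_logb two_pos (by norm_num) hq,
    Real.rpow_natCast]

variable {q : ℕ} [Fact q.Prime]

theorem exists_sum_ind_not_dotEqAt_le (q : ℕ) [Fact q.Prime] : ∃ C : ℝ,
    ∀ (n k₁ k₂ : ℕ) (d : Fin n → ZMod q) (δ R₁ R₂ : ℝ), 0 < n → k₂ ≤ k₁ → k₁ ≤ n →
      0 < δ → R₂ ≤ R₁ → |k₁ * Real.logb 2 q - n * R₁| ≤ n * δ →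
      |k₂ * Real.logb 2 q - n * R₂| ≤ n * δ →
      ∑ G : Matrix (Fin n) (Fin k₁) (ZMod q), ∑ p : (Fin k₁ → ZMod q) × (Fin k₂ → ZMod q),
        ind (¬ DotEqAt (4 * δ) n (msgMult G d p / ((q : ℝ) ^ k₁ * (q : ℝ) ^ k₂))
          (max ((2 : ℝ) ^ (-((n : ℝ) * (R₁ + R₂)))) ((2 : ℝ) ^ (-((n : ℝ) * (max R₁ R₂ + D q))))))
        ≤ matCard q n k₁ * ((q : ℝ) ^ k₁ * (q : ℝ) ^ k₂) *
          (((q : ℝ) ^ 2 + 4) * 2 ^ (-(n * δ)) + (1 + q) / (q : ℝ) ^ k₂ + |C| / (n * δ ^ 2)) := by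
  obtain ⟨C, hC⟩ := exists_sum_ind_not_msgMult_mem_le q
  refine ⟨C, fun n k₁ k₂ d δ R₁ R₂ hn hk₂ hk₁ hδ hR h₁ h₂ => ?_⟩
  have hq1 : (1 : ℝ) ≤ q := by exact_mod_cast (Fact.out : q.Prime).one_le
  have hq : (0 : ℝ) < q := by linarith
  have hM := (matCard_pos q n k₁).le
  have hn' : (0 : ℝ) < n := by exact_mod_cast hn
  have hnδ : 0 < n * δ := by positivity
  rw [max_eq_left hR]
  obtain ⟨h1l, h1u⟩ := abs_le.1 h₁
  obtain ⟨h2l, h2u⟩ := abs_le.1 h₂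
  set L := Real.logb 2 q with hL
  set Δ := D q with hΔ
  have hA : (q : ℝ) ^ k₁ * (q : ℝ) ^ k₂ = 2 ^ (k₁ * L + k₂ * L) := by
    rw [natCast_pow_eq_rpow, natCast_pow_eq_rpow, Real.rpow_add two_pos]
  have mono : ∀ {a b : ℝ}, a ≤ b → (2 : ℝ) ^ a ≤ 2 ^ b := fun h =>
    Real.rpow_le_rpow_of_exponent_le one_le_two h
  -- `Y` bounds the mean number of generic shifts. The choice `τ = κ * max 1 Y` below exceeds the
  -- mean shift count by an exponential factor, up to a constant, so Markov's inequality gains.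
  set Y : ℝ := 2 ^ (k₂ * L + n * (δ - Δ)) with hY
  have hYpos : 0 < Y := by positivity
  have hYeq : (q : ℝ) ^ k₂ * (2 ^ (n * (L - Δ + δ)) / (q : ℝ) ^ n) = Y := by
    rw [natCast_pow_eq_rpow, natCast_pow_eq_rpow, ← Real.rpow_sub two_pos, ← Real.rpow_add two_pos,
      hY]
    congr 1
    ring
  set κ : ℝ := 2 ^ (n * δ) with hκ
  have hκpos : 0 < κ := by positivity
  have hκinv : (2 : ℝ) ^ (-(n * δ)) = κ⁻¹ := Real.rpow_neg two_pos.le _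
  -- This is the multiplicity corresponding to probability `2 ^ (-n (R₁ + D q))`, lowered by the
  -- permitted error `2 ^ (-4 n δ)`.
  set θ : ℝ := 2 ^ (k₁ * L + k₂ * L - n * (R₁ + Δ) - n * (4 * δ)) with hθ
  have hm1 : 1 ≤ max 1 Y := le_max_left _ _
  have hmY : Y ≤ max 1 Y := le_max_right _ _
  have hmain := hC n k₁ k₂ d δ κ (κ * max 1 Y) θ hn hk₂ hk₁ hδ hκpos (by positivity)
    (by positivity)
  have hstep : ∀ (G : Matrix (Fin n) (Fin k₁) (ZMod q))
      (p : (Fin k₁ → ZMod q) × (Fin k₂ → ZMod q)),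
      θ ≤ msgMult G d p ∧ msgMult G d p ≤ κ * (κ * max 1 Y) →
      DotEqAt (4 * δ) n (msgMult G d p / ((q : ℝ) ^ k₁ * (q : ℝ) ^ k₂))
        (max ((2 : ℝ) ^ (-((n : ℝ) * (R₁ + R₂)))) ((2 : ℝ) ^ (-((n : ℝ) * (R₁ + Δ))))) := by
    rintro G p ⟨hlow, hup⟩
    have hone : (1 : ℝ) ≤ msgMult G d p := by exact_mod_cast msgMult_pos G d p
    constructor
    · rw [max_mul_of_nonneg _ _ (by positivity), hA, ← Real.rpow_add two_pos,
        ← Real.rpow_add two_pos]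
      refine max_le ?_ ?_
      · rw [le_div_iff₀ (by positivity), ← Real.rpow_add two_pos]
        refine le_trans ?_ hone
        refine Real.rpow_le_one_of_one_le_of_nonpos one_le_two ?_
        linarith
      · rw [le_div_iff₀ (by positivity), ← Real.rpow_add two_pos]
        refine le_trans (le_of_eq ?_) hlow
        rw [hθ]
        congr 1
        ring
    · rw [hA, div_le_iff₀ (by positivity)]
      refine hup.trans ?_
      rw [max_mul_of_nonneg _ _ (by positivity), max_mul_of_nonneg _ _ (by positivity),
        mul_max_of_nonneg _ _ hκpos.le, mul_max_of_nonneg _ _ hκpos.le]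
      simp only [hκ, hY, ← Real.rpow_add two_pos, mul_one]
      refine max_le_max (mono ?_) (mono ?_) <;> linarith
  rw [hYeq] at hmain
  refine le_trans (Finset.sum_le_sum fun G _ => Finset.sum_le_sum fun p _ =>
    ind_mono fun h hh => h (hstep G p hh)) (hmain.trans ?_)
  refine mul_le_mul_of_nonneg_left ?_ (by positivity)
  rw [hκinv]
  have t1 : 2 / κ = 2 * κ⁻¹ := div_eq_mul_inv _ _
  have t2 : 1 / (q : ℝ) ^ k₂ + q / (q : ℝ) ^ k₁ ≤ (1 + q) / (q : ℝ) ^ k₂ := by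
    rw [add_div]
    have := pow_le_pow_right₀ hq1 hk₂
    gcongr
  have t3 : ((q : ℝ) ^ 2 + Y) / (κ * max 1 Y) ≤ ((q : ℝ) ^ 2 + 1) * κ⁻¹ := by
    rw [← div_eq_mul_inv, div_le_div_iff₀ (by positivity) hκpos]
    have : (q : ℝ) ^ 2 + Y ≤ ((q : ℝ) ^ 2 + 1) * max 1 Y := by
      have := mul_le_mul_of_nonneg_left hm1 (sq_nonneg (q : ℝ))
      linarith
    have := mul_le_mul_of_nonneg_right this hκpos.le
    linarith
  have t4 : 2 ^ (n * (L + Δ + δ)) / (q : ℝ) ^ n / (q : ℝ) ^ k₂ * θ ≤ κ⁻¹ := by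
    rw [natCast_pow_eq_rpow, natCast_pow_eq_rpow, ← Real.rpow_sub two_pos, ← Real.rpow_sub two_pos,
      hθ, ← Real.rpow_add two_pos, ← hκinv]
    refine mono ?_
    linarith
  linarith

/-- Here `k₂` may stay bounded, so independent messages are not used. The target is `2 ^ (-n R₁)`
because `D q ≥ 0`, and `1 ≤ msgMult ≤ kerCard * q ^ k₂` is precise enough. -/
theorem sum_ind_not_dotEqAt_le_of_eq_zero {n k₁ k₂ : ℕ} (d : Fin n → ZMod q) {δ R₁ R₂ : ℝ}
    (hk₁ : k₁ ≤ n) (hδ : 0 < δ) (hR : R₂ ≤ R₁) (hR₂ : R₂ = 0)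
    (h₁ : |k₁ * Real.logb 2 q - n * R₁| ≤ n * δ) (h₂ : |k₂ * Real.logb 2 q - n * R₂| ≤ n * δ) :
    ∑ G : Matrix (Fin n) (Fin k₁) (ZMod q), ∑ p : (Fin k₁ → ZMod q) × (Fin k₂ → ZMod q),
      ind (¬ DotEqAt (4 * δ) n (msgMult G d p / ((q : ℝ) ^ k₁ * (q : ℝ) ^ k₂))
        (max ((2 : ℝ) ^ (-((n : ℝ) * (R₁ + R₂)))) ((2 : ℝ) ^ (-((n : ℝ) * (max R₁ R₂ + D q))))))
      ≤ matCard q n k₁ * ((q : ℝ) ^ k₁ * (q : ℝ) ^ k₂) * (2 * 2 ^ (-(n * δ))) := by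
  have hD := D_nonneg q
  rw [max_eq_left hR]
  subst hR₂
  have hn' : (0 : ℝ) ≤ n := Nat.cast_nonneg n
  have hnδ : 0 ≤ n * δ := by positivity
  obtain ⟨h1l, h1u⟩ := abs_le.1 h₁
  obtain ⟨h2l, h2u⟩ := abs_le.1 h₂
  set L := Real.logb 2 q with hL
  have mono : ∀ {a b : ℝ}, a ≤ b → (2 : ℝ) ^ a ≤ 2 ^ b := fun h =>
    Real.rpow_le_rpow_of_exponent_le one_le_two h
  have hX : max ((2 : ℝ) ^ (-((n : ℝ) * (R₁ + 0)))) ((2 : ℝ) ^ (-((n : ℝ) * (R₁ + D q))))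
      = 2 ^ (-((n : ℝ) * R₁)) := by
    rw [add_zero]
    exact max_eq_left (mono (by linarith [mul_nonneg hn' hD]))
  have hA : (q : ℝ) ^ k₁ * (q : ℝ) ^ k₂ = 2 ^ (k₁ * L + k₂ * L) := by
    rw [natCast_pow_eq_rpow, natCast_pow_eq_rpow, Real.rpow_add two_pos]
  have hmain := sum_ind_kerCard_mul_lt_le (k₂ := k₂) hk₁ d
    (show (0 : ℝ) < 2 ^ (n * δ) by positivity)
  rw [Real.rpow_neg two_pos.le (n * δ), ← div_eq_mul_inv, hX]
  refine le_trans (Finset.sum_le_sum fun G _ => Finset.sum_le_sum fun p _ =>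
    ind_mono fun h => ?_) hmain
  by_contra! hle
  refine h ?_
  have hone : (1 : ℝ) ≤ msgMult G d p := by exact_mod_cast msgMult_pos G d p
  constructor
  · rw [hA, le_div_iff₀ (by positivity), ← Real.rpow_add two_pos, ← Real.rpow_add two_pos]
    refine le_trans ?_ hone
    refine Real.rpow_le_one_of_one_le_of_nonpos one_le_two ?_
    linarith
  · rw [hA, div_le_iff₀ (by positivity)]
    have h3 : (2 : ℝ) ^ (n * δ) * shiftMult G d p ≤ 2 ^ (n * δ) * (q : ℝ) ^ k₂ := by
      have := shiftMult_le G d p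
      gcongr
    refine hle.trans (h3.trans ?_)
    rw [natCast_pow_eq_rpow]
    simp only [← Real.rpow_add two_pos]
    refine mono ?_
    linarith

theorem tendsto_two_rpow_neg {δ : ℝ} (hδ : 0 < δ) :
    Tendsto (fun n : ℕ => (2 : ℝ) ^ (-((n : ℝ) * δ))) atTop (𝓝 0) := by
  have h : Tendsto (fun n : ℕ => ((2 : ℝ) ^ (-δ)) ^ n) atTop (𝓝 0) := by
    refine tendsto_pow_atTop_nhds_zero_of_lt_one (by positivity) ?_
    exact Real.rpow_lt_one_of_one_lt_of_neg one_lt_two (by linarith)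
  refine h.congr fun n => ?_
  rw [← Real.rpow_natCast, ← Real.rpow_mul two_pos.le]
  congr 1
  ring

theorem eventually_abs_sub_le {k : ℕ → ℕ} {R L δ : ℝ} (hδ : 0 < δ)
    (h : Tendsto (fun n : ℕ => (k n : ℝ) / n * L) atTop (𝓝 R)) :
    ∀ᶠ n : ℕ in atTop, |k n * L - n * R| ≤ n * δ := by
  filter_upwards [Metric.tendsto_nhds.1 h δ hδ, eventually_gt_atTop 0] with n hn h0
  have h0' : (0 : ℝ) < n := by exact_mod_cast h0
  rw [Real.dist_eq] at hn
  have : (k n : ℝ) * L - n * R = n * ((k n : ℝ) / n * L - R) := by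
    field_simp
  rw [this, abs_mul, abs_of_pos h0']
  gcongr

theorem exists_tendsto_sum_ind_not_dotEqAt_le (k₁ k₂ : ℕ → ℕ) (hk₂ : ∀ n, k₂ n ≤ k₁ n)
    (hk₁ : ∀ n, k₁ n ≤ n) {R₁ R₂ : ℝ}
    (hR₁ : Tendsto (fun n : ℕ => (k₁ n : ℝ) / n * Real.logb 2 q) atTop (𝓝 R₁))
    (hR₂ : Tendsto (fun n : ℕ => (k₂ n : ℝ) / n * Real.logb 2 q) atTop (𝓝 R₂))
    (d : ∀ n : ℕ, Fin n → ZMod q) {δ : ℝ} (hδ : 0 < δ) :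
    ∃ β : ℕ → ℝ, Tendsto β atTop (𝓝 0) ∧ ∀ᶠ n in atTop,
      ∑ G : Matrix (Fin n) (Fin (k₁ n)) (ZMod q),
        ∑ p : (Fin (k₁ n) → ZMod q) × (Fin (k₂ n) → ZMod q),
        ind (¬ DotEqAt (4 * δ) n (msgMult G (d n) p / ((q : ℝ) ^ k₁ n * (q : ℝ) ^ k₂ n))
          (max ((2 : ℝ) ^ (-((n : ℝ) * (R₁ + R₂)))) ((2 : ℝ) ^ (-((n : ℝ) * (max R₁ R₂ + D q))))))
        ≤ matCard q n (k₁ n) * ((q : ℝ) ^ k₁ n * (q : ℝ) ^ k₂ n) * β n := by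
  have hq1 : (1 : ℝ) < q := by exact_mod_cast (Fact.out : q.Prime).one_lt
  have hL : 0 < Real.logb 2 q := Real.logb_pos one_lt_two hq1
  have hR : R₂ ≤ R₁ := by
    refine le_of_tendsto_of_tendsto' hR₂ hR₁ fun n => ?_
    have : (k₂ n : ℝ) ≤ k₁ n := by exact_mod_cast hk₂ n
    gcongr
  have hR₂0 : 0 ≤ R₂ := ge_of_tendsto' hR₂ fun n => by positivity
  have hpow := tendsto_two_rpow_neg hδ
  rcases hR₂0.eq_or_lt with h0 | hpos
  · refine ⟨fun n => 2 * 2 ^ (-(n * δ)), by simpa using hpow.const_mul 2, ?_⟩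
    filter_upwards [eventually_abs_sub_le hδ hR₁, eventually_abs_sub_le hδ hR₂] with n h₁ h₂
    exact sum_ind_not_dotEqAt_le_of_eq_zero (d n) (hk₁ n) hδ hR h0.symm h₁ h₂
  · obtain ⟨C, hC⟩ := exists_sum_ind_not_dotEqAt_le q
    refine ⟨fun n => ((q : ℝ) ^ 2 + 4) * 2 ^ (-(n * δ)) + (1 + q) / (q : ℝ) ^ k₂ n
      + |C| / (n * δ ^ 2), ?_, ?_⟩
    -- A positive `R₂` forces `k₂` to infinity, which makes dependent messages negligible.
    · have hk : Tendsto k₂ atTop atTop := by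
        rw [← tendsto_natCast_atTop_iff (R := ℝ)]
        have h1 : Tendsto (fun n : ℕ => (n : ℝ) * ((k₂ n : ℝ) / n * Real.logb 2 q)) atTop atTop :=
          tendsto_natCast_atTop_atTop.atTop_mul_pos hpos hR₂
        have h2 := h1.atTop_mul_const (inv_pos.2 hL)
        refine h2.congr' ?_
        filter_upwards [eventually_gt_atTop 0] with n hn
        have : (n : ℝ) ≠ 0 := by exact_mod_cast hn.ne'
        field_simp
      have t1 := hpow.const_mul ((q : ℝ) ^ 2 + 4)
      have t2 : Tendsto (fun n => (1 + (q : ℝ)) / (q : ℝ) ^ k₂ n) atTop (𝓝 0) :=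
        tendsto_const_nhds.div_atTop ((tendsto_pow_atTop_atTop_of_one_lt hq1).comp hk)
      have t3 : Tendsto (fun n : ℕ => |C| / ((n : ℝ) * δ ^ 2)) atTop (𝓝 0) :=
        tendsto_const_nhds.div_atTop
          (tendsto_natCast_atTop_atTop.atTop_mul_const (by positivity))
      simpa using (t1.add t2).add t3
    · filter_upwards [eventually_abs_sub_le hδ hR₁, eventually_abs_sub_le hδ hR₂,
        eventually_gt_atTop 0] with n h₁ h₂ hn
      exact hC n (k₁ n) (k₂ n) (d n) δ R₁ R₂ hn (hk₂ n) (hk₁ n) hδ hR h₁ h₂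

end Asymptotics

end TypicalSumset

/-! ### The theorem: Markov's inequality over the matrix -/

theorem theorem1 (q : ℕ) [Fact q.Prime]
    (k₁ k₂ : ℕ → ℕ) (hk₂ : ∀ n, k₂ n ≤ k₁ n) (hk₁ : ∀ n, k₁ n ≤ n)
    (R₁ R₂ : ℝ)
    (hR₁ : Tendsto (fun n : ℕ => (k₁ n : ℝ) / n * Real.logb 2 q) atTop (𝓝 R₁))
    (hR₂ : Tendsto (fun n : ℕ => (k₂ n : ℝ) / n * Real.logb 2 q) atTop (𝓝 R₂))
    (d : ∀ n : ℕ, Fin n → ZMod q)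
    {Ω : Type*} [MeasurableSpace Ω] (P : Measure Ω) [IsProbabilityMeasure P]
    (G : ∀ n : ℕ, Ω → Matrix (Fin n) (Fin (k₁ n)) (ZMod q))
    (hG_meas : ∀ (n : ℕ) (i : Fin n) (j : Fin (k₁ n)) (a : ZMod q),
      MeasurableSet {ω | G n ω i j = a})
    (hG_unif : ∀ (n : ℕ) (i : Fin n) (j : Fin (k₁ n)) (a : ZMod q),
      P {ω | G n ω i j = a} = (q : ENNReal)⁻¹)
    (hG_indep : ∀ n : ℕ, iIndepFun (m := fun _ => ⊤)
      (fun (p : Fin n × Fin (k₁ n)) (ω : Ω) => G n ω p.1 p.2) P) :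
    ∃ ε η : ℕ → ℝ, Antitone ε ∧ Tendsto ε atTop (𝓝 0) ∧ Tendsto η atTop (𝓝 0) ∧
      Tendsto (fun n : ℕ => P {ω | ∃ K : Set (Fin n → ℤ),
        TypicalSumset.IsNormalTypical q R₁ R₂ (ε n) (η n)
          (TypicalSumset.toInt (TypicalSumset.coset (TypicalSumset.code₁ (G n ω)) (d n)))
          (TypicalSumset.toInt (TypicalSumset.code₂ (k₂ n) (G n ω))) K})
        atTop (𝓝 1) := by
  classical
  refine (TypicalSumset.exists_antitone_scale (p := fun n x => P {ω | ∃ K : Set (Fin n → ℤ),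
    TypicalSumset.IsNormalTypical q R₁ R₂ x x
      (TypicalSumset.toInt (TypicalSumset.coset (TypicalSumset.code₁ (G n ω)) (d n)))
      (TypicalSumset.toInt (TypicalSumset.code₂ (k₂ n) (G n ω))) K})
    (fun _ _ => prob_le_one) ?_).imp fun e he => ⟨e, he.1, he.2.1, he.2.1, he.2.2⟩
  intro x hx
  -- The error `4 δ` in the point masses is doubled in the size of the set, giving `8 δ = x`.
  have hδ : 0 < x / 8 := by positivity
  -- The cap at `1 / 2` keeps `1 - η` above `2 ^ (-n x / 2)` for large `n`.
  set η := min x (1 / 2) with hη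
  have hη0 : 0 < η := lt_min hx (by norm_num)
  obtain ⟨β, hβ, hbound⟩ := TypicalSumset.exists_tendsto_sum_ind_not_dotEqAt_le k₁ k₂ hk₂ hk₁
    hR₁ hR₂ d hδ
  have hlow : Tendsto (fun n => ENNReal.ofReal (1 - β n / η)) atTop (𝓝 1) := by
    have h1 : Tendsto (fun n => 1 - β n / η) atTop (𝓝 1) := by
      simpa using (hβ.div_const η).const_sub 1
    simpa using ENNReal.tendsto_ofReal h1
  refine tendsto_of_tendsto_of_tendsto_of_le_of_le' hlow tendsto_const_nhds ?_
    (Eventually.of_forall fun _ => prob_le_one)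
  have hsmall := (TypicalSumset.tendsto_two_rpow_neg (show 0 < 4 * (x / 8) by positivity)).eventually
    (ge_mem_nhds (show (0 : ℝ) < 1 / 2 by norm_num))
  filter_upwards [hbound, hsmall] with n hn hs
  have hM := TypicalSumset.matCard_pos q n (k₁ n)
  have hq : (0 : ℝ) < q := by exact_mod_cast (Fact.out : q.Prime).pos
  set N : ℝ := (q : ℝ) ^ k₁ n * (q : ℝ) ^ k₂ n with hN
  have hNpos : 0 < N := by positivity
  set bad : Matrix (Fin n) (Fin (k₁ n)) (ZMod q) → ℝ := fun g =>
    ∑ p : (Fin (k₁ n) → ZMod q) × (Fin (k₂ n) → ZMod q),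
      TypicalSumset.ind (¬ TypicalSumset.DotEqAt (4 * (x / 8)) n
        (TypicalSumset.msgMult g (d n) p / N)
        (max ((2 : ℝ) ^ (-((n : ℝ) * (R₁ + R₂))))
          ((2 : ℝ) ^ (-((n : ℝ) * (max R₁ R₂ + TypicalSumset.D q)))))) with hbad
  have hbad0 : ∀ g, 0 ≤ bad g := fun g => Finset.sum_nonneg fun _ _ => TypicalSumset.ind_nonneg _
  have hsub : {ω | bad (G n ω) ≤ η * N} ⊆ {ω | ∃ K : Set (Fin n → ℤ),
      TypicalSumset.IsNormalTypical q R₁ R₂ x x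
        (TypicalSumset.toInt (TypicalSumset.coset (TypicalSumset.code₁ (G n ω)) (d n)))
        (TypicalSumset.toInt (TypicalSumset.code₂ (k₂ n) (G n ω))) K} := by
    intro ω hω
    obtain ⟨K, hK⟩ := TypicalSumset.exists_isNormalTypical (by positivity) (G n ω) (d n)
      (hs.trans (by linarith [min_le_right x (1 / 2)])) hω
    exact ⟨K, hK.mono (by linarith) (min_le_left _ _)⟩
  refine le_trans ?_ (measure_mono hsub)
  rw [TypicalSumset.prob_matrix_mem (hG_meas n) (hG_unif n) (hG_indep n)
    (fun g => bad g ≤ η * N)]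
  refine ENNReal.ofReal_le_ofReal ?_
  rw [← TypicalSumset.sum_ind, ← TypicalSumset.matCard, le_div_iff₀ hM]
  -- Markov's inequality in pointwise form; averaged over matrices, it bounds the failure
  -- probability by `β n / η`.
  have hcompl : ∀ g, 1 - bad g / (η * N) ≤ TypicalSumset.ind (bad g ≤ η * N) := by
    intro g
    by_cases hg : bad g ≤ η * N
    · rw [TypicalSumset.ind_of_true hg]
      have := div_nonneg (hbad0 g) (by positivity : 0 ≤ η * N)
      linarith
    · have h1 : 1 ≤ bad g / (η * N) := by
        rw [one_le_div (by positivity)]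
        exact (not_le.1 hg).le
      have := TypicalSumset.ind_nonneg (bad g ≤ η * N)
      linarith
  refine le_trans ?_ (Finset.sum_le_sum fun g _ => hcompl g)
  rw [Finset.sum_sub_distrib, ← Finset.sum_div, Finset.sum_const, Finset.card_univ, nsmul_eq_mul,
    mul_one, ← TypicalSumset.matCard, sub_mul, one_mul]
  refine sub_le_sub_left ?_ _
  rw [div_le_iff₀ (by positivity)]
  refine hn.trans (le_of_eq ?_)
  field_simp
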